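/- Let $D\subset\mathbb{C}$ be the open unit disc, $\mathcal{A}=\{(\alpha,\beta)\in D\times D:\alpha\neq\beta\}$, let $\lambda:\mathcal{A}\to\mathcal{A}$ be the swap $(\alpha,\beta)\mapsto(\beta,\alpha)$, and let $$S(\alpha,\beta)=\frac{|1-\alpha|\,|1-\beta|}{|1+\alpha|\,|1+\beta|}.$$ Let $$\tilde{\mathcal{A}}=\{(p,k,\tilde u,\tilde v)\in\mathbb{R}^+\times(0,1)\times\mathbb{R}\times\mathbb{R}:\ \tilde u<\tilde v<\tilde u+2\pi\},$$ and put $u=\tan(\tilde u/2)$, $v=\tan(\tilde v/2)$ (points of $\mathbb{R}\cup\{\infty\}$) and $w(ix)=\sqrt{(1+x^2)(1+k^2x^2)}$ for $x\in\mathbb{R}$. The covering map $\tilde\pi:\tilde{\mathcal{A}}\to\mathcal{A}$ is $\tilde\pi(p,k,\tilde u,\tilde v)=(f^{-1}(1),f^{-1}(k^{-1}))$, where $$f^{-1}(z)=\frac{iu+\bar z_0}{iu-z_0}\cdot\frac{z-z_0}{z+\bar z_0},\qquad z_0=\frac{\sqrt{p\,w(iu)w(iv)}\,|u-v|+i\,(p\,u\,w(iv)+v\,w(iu))}{p\,w(iv)+w(iu)},$$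 extended continuously to $u=\infty$ and to $v=\infty$. Let $K=K(k)$ and $E=E(k)$ be the complete elliptic integrals of the first and second kind with modulus $k$, put $$\tilde F(x)=\frac12\int_0^x\frac{ds}{\sqrt{\cos^2\frac s2+k^2\sin^2\frac s2}},\qquad \tilde E(x)=\frac{1-k^2}{2}\int_0^x\frac{ds}{\sqrt{\cos^2\frac s2+k^2\sin^2\frac s2}+k},$$ and define $\tilde T:\tilde{\mathcal{A}}\to\mathbb{R}$ by $$2\pi\tilde T=4p\,[E\tilde F(\tilde v)-K\tilde E(\tilde v)]-4\,[E\tilde F(\tilde u)-K\tilde E(\tilde u)]-4K\Big[p\Big(\frac{w(iv)}{u-v}+kv\Big)+\Big(\frac{w(iu)}{u-v}-ku\Big)\Big],$$ the last bracket being extended analytically to $u=\infty$ and to $v=\infty$. For $m>0$ let $r_m:\mathbb{R}\to\mathbb{R}$ be the increasing homeomorphism with $\tan(r_m(x)/2)=m\tan(x/2)$ (as points of $\mathbb{R}\cup\{\infty\}$) that fixes every point of $\pi\mathbb{Z}$, and put $\tilde U=r_{\sqrt k}(\tilde u)$, $\tilde V=r_{\sqrt k}(\tilde v)$. Then $(p,k,\tilde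 U,\tilde V)$ are again coordinates on $\tilde{\mathcal{A}}$, with range $p>0$, $0<k<1$, $\tilde U<\tilde V<\tilde U+2\pi$. Let $\tilde\lambda:\tilde{\mathcal{A}}\to\tilde{\mathcal{A}}$ be the homeomorphism that in these coordinates is $$\tilde\lambda:(p,k,\tilde U,\tilde V)\mapsto(p,k,\tilde U+\pi,\tilde V+\pi).$$ Then: 1. $\tilde\lambda$ lifts the swap: $\tilde\pi\circ\tilde\lambda=\lambda\circ\tilde\pi$. 2. $\tilde T\circ\tilde\lambda-\tilde T=S\circ\tilde\pi-1$ on $\tilde{\mathcal{A}}$. 3. For every $p>0$, $\tilde\lambda$ maps $\tilde{\mathcal{A}}(p)=\{x\in\tilde{\mathcal{A}}:S(\tilde\pi(x))=p\}$ into itself. Write $q=\tilde T$, and $\tilde X=\tilde U$ if $p\le1$, $\tilde X=\tilde V$ if $p\ge1$ (for $p=1$ either choice). If $x\in\tilde{\mathcal{A}}(p)$ has $(q,k,\tilde X)$-coordinates $(q,k,\tilde X)$, then $\tilde\lambda(x)$ has $(q,k,\tilde X)$-coordinates $(q+p-1,\,k,\,\tilde X+\pi)$. -/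

import Mathlib

open scoped ComplexConjugate

noncomputable section

namespace GenusOne

/-- The parameter space `(D × D) ∖ Δ` of ordered pairs of distinct points of the open unit disc. -/
abbrev ParamSpace : Type :=
  {a : ℂ × ℂ // ‖a.1‖ < 1 ∧ ‖a.2‖ < 1 ∧ a.1 ≠ a.2}

/-- The involution `(α, β) ↦ (β, α)`. -/
def swap (a : ParamSpace) : ParamSpace :=
  ⟨(a.1.2, a.1.1), a.2.2.1, a.2.1, a.2.2.2.symm⟩

/-- `S(α, β) = |1 - α| |1 - β| / (|1 + α| |1 + β|)`. -/
def S (a : ParamSpace) : ℝ :=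
  (‖1 - a.1.1‖ * ‖1 - a.1.2‖) / (‖1 + a.1.1‖ * ‖1 + a.1.2‖)

/-- The universal cover: quadruples `(p, k, ũ, ṽ)` with `p > 0`, `0 < k < 1` and
`ũ < ṽ < ũ + 2π`. -/
abbrev Cover : Type :=
  {x : ℝ × ℝ × ℝ × ℝ // 0 < x.1 ∧ (0 < x.2.1 ∧ x.2.1 < 1) ∧
    x.2.2.1 < x.2.2.2 ∧ x.2.2.2 < x.2.2.1 + 2 * Real.pi}

namespace Cover

/-- The coordinate `p`. -/
def p (x : Cover) : ℝ := x.1.1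

/-- The coordinate `k`, an elliptic modulus. -/
def k (x : Cover) : ℝ := x.1.2.1

/-- The coordinate `ũ`. -/
def u (x : Cover) : ℝ := x.1.2.2.1

/-- The coordinate `ṽ`. -/
def v (x : Cover) : ℝ := x.1.2.2.2

lemma p_pos (x : Cover) : 0 < x.p := x.2.1
lemma k_pos (x : Cover) : 0 < x.k := x.2.2.1.1
lemma k_lt_one (x : Cover) : x.k < 1 := x.2.2.1.2
lemma u_lt_v (x : Cover) : x.u < x.v := x.2.2.2.1
lemma v_lt (x : Cover) : x.v < x.u + 2 * Real.pi := x.2.2.2.2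

end Cover

/-! ### The projection to the parameter space -/

/-- `√(cos²(x/2) + k² sin²(x/2))`. If `t = tan (x/2)` is finite then
`w(i t) = √((1 + t²)(1 + k² t²)) = delta k x / cos²(x/2)`. -/
def delta (k x : ℝ) : ℝ :=
  Real.sqrt (Real.cos (x / 2) ^ 2 + k ^ 2 * Real.sin (x / 2) ^ 2)

/-- `p w(i v) + w(i u)` multiplied by `cos²(ũ/2) cos²(ṽ/2)`. -/
def zDen (p k u v : ℝ) : ℝ :=
  p * delta k v * Real.cos (u / 2) ^ 2 + delta k u * Real.cos (v / 2) ^ 2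

/-- The point `z₀ = f(0)`. With `u = tan (ũ/2)` and `v = tan (ṽ/2)` it is
`(√(p w(iu) w(iv)) |u - v| + i (p u w(iv) + v w(iu))) / (p w(iv) + w(iu))`; numerator and
denominator are multiplied by `cos²(ũ/2) cos²(ṽ/2)`, so that `u = ∞` and `v = ∞` are covered. -/
def zZero (p k u v : ℝ) : ℂ :=
  ⟨Real.sqrt (p * delta k u * delta k v) * |Real.sin ((u - v) / 2)| / zDen p k u v,
    (p * Real.sin (u / 2) * Real.cos (u / 2) * delta k v
      + Real.sin (v / 2) * Real.cos (v / 2) * delta k u) / zDen p k u v⟩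

/-- The Möbius transformation `f⁻¹(z) = ((i u + z̄₀) / (i u - z₀)) ((z - z₀) / (z + z̄₀))`,
`u = tan (ũ/2)`; the first fraction is multiplied through by `cos (ũ/2)`. -/
def fInv (p k u v : ℝ) (z : ℂ) : ℂ :=
  (Complex.I * (Real.sin (u / 2) : ℂ) + conj (zZero p k u v) * (Real.cos (u / 2) : ℂ)) /
    (Complex.I * (Real.sin (u / 2) : ℂ) - zZero p k u v * (Real.cos (u / 2) : ℂ)) *
  ((z - zZero p k u v) / (z + conj (zZero p k u v)))

lemma delta_pos {k : ℝ} (hk : 0 < k) (x : ℝ) : 0 < delta k x := by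
  apply Real.sqrt_pos.2
  have h := Real.sin_sq_add_cos_sq (x / 2)
  by_cases hc : Real.cos (x / 2) = 0
  · have hs : Real.sin (x / 2) ^ 2 = 1 := by rw [hc] at h; linarith
    rw [hc, hs]; positivity
  · positivity

lemma Cover.sin_ne (x : Cover) : Real.sin ((x.u - x.v) / 2) ≠ 0 := by
  have h1 := x.u_lt_v
  have h2 := x.v_lt
  exact (Real.sin_neg_of_neg_of_neg_pi_lt (by linarith) (by linarith)).ne

lemma Cover.zDen_pos (x : Cover) : 0 < zDen x.p x.k x.u x.v := by
  have hu := delta_pos x.k_pos x.u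
  have hv := delta_pos x.k_pos x.v
  have hp := x.p_pos
  unfold zDen
  by_cases hc : Real.cos (x.u / 2) = 0
  · have hd : Real.cos (x.v / 2) ≠ 0 := by
      intro hd
      apply x.sin_ne
      rw [sub_div, Real.sin_sub, hc, hd]; ring
    positivity
  · positivity

lemma Cover.zZero_re_pos (x : Cover) : 0 < (zZero x.p x.k x.u x.v).re := by
  have hu := delta_pos x.k_pos x.u
  have hv := delta_pos x.k_pos x.v
  have hp := x.p_pos
  have hs := abs_pos.2 x.sin_ne
  have hd := x.zDen_pos
  simp only [zZero]
  positivity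

lemma Cover.norm_fInv_pre (x : Cover) :
    ‖(Complex.I * (Real.sin (x.u / 2) : ℂ)
        + conj (zZero x.p x.k x.u x.v) * (Real.cos (x.u / 2) : ℂ)) /
      (Complex.I * (Real.sin (x.u / 2) : ℂ)
        - zZero x.p x.k x.u x.v * (Real.cos (x.u / 2) : ℂ))‖ = 1 := by
  have hz := x.zZero_re_pos
  set z := zZero x.p x.k x.u x.v
  set s := Real.sin (x.u / 2) with hs
  set c := Real.cos (x.u / 2) with hc
  have hsc : s ^ 2 + c ^ 2 = 1 := Real.sin_sq_add_cos_sq _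
  have hne : Complex.I * (s : ℂ) - z * (c : ℂ) ≠ 0 := by
    intro h
    have hre := congrArg Complex.re h
    have him := congrArg Complex.im h
    simp at hre him
    rcases hre with h0 | h0
    · exact hz.ne' h0
    · rw [h0] at him hsc; simp at him; rw [him] at hsc; norm_num at hsc
  have hconj : Complex.I * (s : ℂ) + conj z * (c : ℂ)
      = -conj (Complex.I * (s : ℂ) - z * (c : ℂ)) := by
    simp [add_comm]
  rw [hconj, norm_div, norm_neg, RCLike.norm_conj, div_self (norm_ne_zero_iff.2 hne)]

lemma Cover.add_conj_ne (x : Cover) {t : ℝ} (ht : 0 < t) :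
    (t : ℂ) + conj (zZero x.p x.k x.u x.v) ≠ 0 := by
  intro h
  have hre := congrArg Complex.re h
  simp at hre
  have := x.zZero_re_pos
  linarith

lemma Cover.norm_fInv_lt (x : Cover) {t : ℝ} (ht : 0 < t) :
    ‖fInv x.p x.k x.u x.v (t : ℂ)‖ < 1 := by
  have hz := x.zZero_re_pos
  have hne := x.add_conj_ne ht
  unfold fInv
  rw [norm_mul, x.norm_fInv_pre, one_mul, norm_div, div_lt_one (norm_pos_iff.2 hne)]
  apply lt_of_pow_lt_pow_left₀ 2 (norm_nonneg _)
  rw [Complex.sq_norm, Complex.sq_norm, Complex.normSq_apply, Complex.normSq_apply]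
  simp
  nlinarith [mul_pos ht hz]

lemma Cover.fInv_ne (x : Cover) :
    fInv x.p x.k x.u x.v ((1 : ℝ) : ℂ) ≠ fInv x.p x.k x.u x.v (((x.k)⁻¹ : ℝ) : ℂ) := by
  have hz := x.zZero_re_pos
  have hk := x.k_pos
  have h1 := x.add_conj_ne one_pos
  have h2 := x.add_conj_ne (inv_pos.2 hk)
  have hk1 : 1 < (x.k)⁻¹ := (one_lt_inv₀ hk).2 x.k_lt_one
  have hpre := x.norm_fInv_pre
  intro h
  unfold fInv at h
  have hpre0 := norm_ne_zero_iff.1 (hpre.trans_ne one_ne_zero)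
  have h3 := mul_left_cancel₀ hpre0 h
  rw [div_eq_div_iff h1 h2] at h3
  have hre := congrArg Complex.re h3
  simp at hre
  nlinarith [mul_pos hz (sub_pos.2 hk1)]

/-- The covering map to the parameter space:
`(p, k, ũ, ṽ) ↦ (α, β) = (f⁻¹(1), f⁻¹(1/k))`. -/
def proj (x : Cover) : ParamSpace :=
  ⟨(fInv x.p x.k x.u x.v ((1 : ℝ) : ℂ), fInv x.p x.k x.u x.v (((x.k)⁻¹ : ℝ) : ℂ)),
    x.norm_fInv_lt one_pos, x.norm_fInv_lt (inv_pos.2 x.k_pos), x.fInv_ne⟩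

/-! ### The lifted function -/

/-- The complete elliptic integral of the first kind, with modulus `k`. -/
def ellipticK (k : ℝ) : ℝ :=
  ∫ t in (0 : ℝ)..(Real.pi / 2), 1 / Real.sqrt (1 - k ^ 2 * Real.sin t ^ 2)

/-- The complete elliptic integral of the second kind, with modulus `k`. -/
def ellipticE (k : ℝ) : ℝ :=
  ∫ t in (0 : ℝ)..(Real.pi / 2), Real.sqrt (1 - k ^ 2 * Real.sin t ^ 2)

/-- The analytic continuation in `x` of `Im F(i tan (x/2); k)`, the incomplete elliptic integral
of the first kind. -/
def liftedF (x k : ℝ) : ℝ :=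
  1 / 2 * ∫ s in (0 : ℝ)..x, 1 / delta k s

/-- The analytic continuation in `x` of `Im (E(i t; k) - k i t)`, `t = tan (x/2)`, where `E` is the
incomplete elliptic integral of the second kind. -/
def liftedE (x k : ℝ) : ℝ :=
  1 / 2 * (1 - k ^ 2) * ∫ s in (0 : ℝ)..x, 1 / (delta k s + k)

/-- The analytic extension of `w(i a)/(a - b) - k a`, where `a = tan (x/2)`, `b = tan (y/2)`,
across `a = ∞` and `b = ∞`, for `a ≠ b` (see `boundaryTerm_eq`). -/
def boundaryTerm (k x y : ℝ) : ℝ :=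
  (Real.cos (x / 2) * Real.cos (y / 2) * (1 + k ^ 2 * Real.sin (x / 2) ^ 2)
      / (delta k x + k * Real.sin (x / 2) ^ 2)
    + k * Real.sin (x / 2) * Real.sin (y / 2)) / Real.sin ((x - y) / 2)

lemma boundaryTerm_eq {k : ℝ} (hk : 0 < k) {x y : ℝ} (hx : Real.cos (x / 2) ≠ 0)
    (hy : Real.cos (y / 2) ≠ 0) (hxy : Real.sin ((x - y) / 2) ≠ 0) :
    boundaryTerm k x y =
      Real.sqrt ((1 + Real.tan (x / 2) ^ 2) * (1 + k ^ 2 * Real.tan (x / 2) ^ 2))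
        / (Real.tan (x / 2) - Real.tan (y / 2)) - k * Real.tan (x / 2) := by
  have hd := delta_pos hk x
  have hsq : delta k x ^ 2 = Real.cos (x / 2) ^ 2 + k ^ 2 * Real.sin (x / 2) ^ 2 :=
    Real.sq_sqrt (by positivity)
  have hw : Real.sqrt ((1 + Real.tan (x / 2) ^ 2) * (1 + k ^ 2 * Real.tan (x / 2) ^ 2))
      = delta k x / Real.cos (x / 2) ^ 2 := by
    rw [Real.sqrt_eq_iff_mul_self_eq (by positivity) (by positivity), Real.tan_eq_sin_div_cos]
    have h1 := Real.sin_sq_add_cos_sq (x / 2)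
    field_simp
    rw [hsq]
    linear_combination (Real.cos (x / 2) ^ 2 + k ^ 2 * Real.sin (x / 2) ^ 2) * h1
  have hsin : Real.sin ((x - y) / 2) = Real.sin (x / 2) * Real.cos (y / 2)
      - Real.cos (x / 2) * Real.sin (y / 2) := by rw [sub_div, Real.sin_sub]
  rw [hsin] at hxy
  have htan : Real.tan (x / 2) - Real.tan (y / 2) = (Real.sin (x / 2) * Real.cos (y / 2)
      - Real.cos (x / 2) * Real.sin (y / 2)) / (Real.cos (x / 2) * Real.cos (y / 2)) := by
    rw [Real.tan_eq_sin_div_cos, Real.tan_eq_sin_div_cos]; field_simp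
  have hd2 : delta k x + k * Real.sin (x / 2) ^ 2 ≠ 0 := by positivity
  have key : Real.cos (x / 2) ^ 2 * (1 + k ^ 2 * Real.sin (x / 2) ^ 2)
      / (delta k x + k * Real.sin (x / 2) ^ 2) = delta k x - k * Real.sin (x / 2) ^ 2 := by
    rw [div_eq_iff hd2]
    have h1 := Real.sin_sq_add_cos_sq (x / 2)
    linear_combination (-1 : ℝ) * hsq + k ^ 2 * Real.sin (x / 2) ^ 2 * h1
  rw [hw, htan, boundaryTerm, hsin, Real.tan_eq_sin_div_cos]
  have e1 : Real.cos (x / 2) * Real.cos (y / 2) * (1 + k ^ 2 * Real.sin (x / 2) ^ 2)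
      / (delta k x + k * Real.sin (x / 2) ^ 2)
      = Real.cos (y / 2) / Real.cos (x / 2) * (delta k x - k * Real.sin (x / 2) ^ 2) := by
    rw [← key]; field_simp
  rw [e1]
  set D := Real.sin (x / 2) * Real.cos (y / 2) - Real.cos (x / 2) * Real.sin (y / 2) with hD
  clear_value D
  field_simp
  linear_combination k * Real.sin (x / 2) * hD

/-- The function `T̃` on the universal cover. With `u = tan (ũ/2)`, `v = tan (ṽ/2)`,
`2π T̃ = 4p (E F̃(ṽ) - K Ẽ(ṽ)) - 4 (E F̃(ũ) - K Ẽ(ũ))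
  - 4K (p (w(iv)/(u - v) + k v) + (w(iu)/(u - v) - k u))`. -/
def liftedT (x : Cover) : ℝ :=
  (4 * x.p * (ellipticE x.k * liftedF x.v x.k - ellipticK x.k * liftedE x.v x.k)
    - 4 * (ellipticE x.k * liftedF x.u x.k - ellipticK x.k * liftedE x.u x.k)
    - 4 * ellipticK x.k * (x.p * (-boundaryTerm x.k x.v x.u) + boundaryTerm x.k x.u x.v))
  / (2 * Real.pi)

/-! ### The covering transformation -/

/-- For `m > 0`, the lift to `ℝ` of the map `tan (x/2) ↦ m tan (x/2)` of `ℝ ∪ {∞}` that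
fixes `πℤ` pointwise (see `rescale_eq`). -/
def rescale (m x : ℝ) : ℝ :=
  x + 2 * Real.arctan ((m - 1) * (Real.sin (x / 2) * Real.cos (x / 2))
    / (Real.cos (x / 2) ^ 2 + m * Real.sin (x / 2) ^ 2))

lemma rescale_den_pos {m : ℝ} (hm : 0 < m) (x : ℝ) :
    0 < Real.cos (x / 2) ^ 2 + m * Real.sin (x / 2) ^ 2 := by
  have h := Real.sin_sq_add_cos_sq (x / 2)
  by_cases hc : Real.cos (x / 2) = 0
  · have hs : Real.sin (x / 2) ^ 2 = 1 := by rw [hc] at h; linarith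
    rw [hc, hs]; positivity
  · positivity

lemma rescale_half {m : ℝ} (hm : 0 < m) (x : ℝ) : ∃ r : ℝ, 0 < r ∧
    Real.cos (rescale m x / 2) = r * Real.cos (x / 2) ∧
    Real.sin (rescale m x / 2) = r * (m * Real.sin (x / 2)) := by
  have hN := rescale_den_pos hm x
  have h := Real.sin_sq_add_cos_sq (x / 2)
  set t := (m - 1) * (Real.sin (x / 2) * Real.cos (x / 2))
    / (Real.cos (x / 2) ^ 2 + m * Real.sin (x / 2) ^ 2) with ht
  have hR : 0 < Real.sqrt (1 + t ^ 2) := Real.sqrt_pos.2 (by positivity)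
  have e : rescale m x / 2 = x / 2 + Real.arctan t := by unfold rescale; rw [← ht]; ring
  have this : t * (Real.cos (x / 2) ^ 2 + m * Real.sin (x / 2) ^ 2)
      = (m - 1) * (Real.sin (x / 2) * Real.cos (x / 2)) := by rw [ht]; field_simp
  clear_value t
  refine ⟨1 / ((Real.cos (x / 2) ^ 2 + m * Real.sin (x / 2) ^ 2) * Real.sqrt (1 + t ^ 2)),
    by positivity, ?_, ?_⟩
  · rw [e, Real.cos_add, Real.cos_arctan, Real.sin_arctan]
    field_simp
    rw [eq_div_iff (by rw [mul_comm m] at hN; exact hN.ne')]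
    linear_combination (-Real.sin (x / 2)) * this + Real.cos (x / 2) * h
  · rw [e, Real.sin_add, Real.cos_arctan, Real.sin_arctan]
    field_simp
    rw [eq_div_iff (by rw [mul_comm m] at hN; exact hN.ne')]
    linear_combination Real.cos (x / 2) * this + m * Real.sin (x / 2) * h

lemma rescale_eq {m : ℝ} (hm : 0 < m) (n : ℤ) {x : ℝ} (h1 : -Real.pi < x - 2 * Real.pi * n)
    (h2 : x - 2 * Real.pi * n < Real.pi) :
    rescale m x = 2 * Real.pi * n + 2 * Real.arctan (m * Real.tan (x / 2)) := by
  set a := (x - 2 * Real.pi * n) / 2 with ha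
  have hc : 0 < Real.cos a := Real.cos_pos_of_mem_Ioo ⟨by linarith, by linarith⟩
  have hx : x / 2 = a + n * Real.pi := by rw [ha]; ring
  have htan : Real.tan (x / 2) = Real.tan a := by rw [hx, Real.tan_add_int_mul_pi]
  have hcx : Real.cos (x / 2) ≠ 0 := by
    rw [hx, Real.cos_add_int_mul_pi]
    exact mul_ne_zero (zpow_ne_zero _ (by norm_num)) hc.ne'
  have hN := rescale_den_pos hm x
  have e : (m - 1) * (Real.sin (x / 2) * Real.cos (x / 2))
      / (Real.cos (x / 2) ^ 2 + m * Real.sin (x / 2) ^ 2)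
      = (m * Real.tan a + -Real.tan a) / (1 - m * Real.tan a * -Real.tan a) := by
    rw [← htan, Real.tan_eq_sin_div_cos]
    have : (1 - m * (Real.sin (x / 2) / Real.cos (x / 2))
        * -(Real.sin (x / 2) / Real.cos (x / 2)))
        = (Real.cos (x / 2) ^ 2 + m * Real.sin (x / 2) ^ 2) / Real.cos (x / 2) ^ 2 := by
      field_simp; ring
    rw [this]; field_simp; ring
  have hlt : m * Real.tan a * -Real.tan a < 1 := by nlinarith [mul_nonneg hm.le (sq_nonneg (Real.tan a))]
  unfold rescale
  rw [e, ← Real.arctan_add hlt, Real.arctan_neg,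
    Real.arctan_tan (by linarith) (by linarith), htan, ha]
  ring

lemma rescale_inv {m : ℝ} (hm : 0 < m) (x : ℝ) : rescale m⁻¹ (rescale m x) = x := by
  obtain ⟨r, hr, hc, hs⟩ := rescale_half hm x
  have hN := rescale_den_pos hm x
  have e : (m⁻¹ - 1) * (Real.sin (rescale m x / 2) * Real.cos (rescale m x / 2))
      / (Real.cos (rescale m x / 2) ^ 2 + m⁻¹ * Real.sin (rescale m x / 2) ^ 2)
      = -((m - 1) * (Real.sin (x / 2) * Real.cos (x / 2))
        / (Real.cos (x / 2) ^ 2 + m * Real.sin (x / 2) ^ 2)) := by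
    rw [hc, hs]
    have : (r * Real.cos (x / 2)) ^ 2 + m⁻¹ * (r * (m * Real.sin (x / 2))) ^ 2
      = r ^ 2 * (Real.cos (x / 2) ^ 2 + m * Real.sin (x / 2) ^ 2) := by field_simp
    rw [this]
    field_simp
    ring
  rw [rescale, e, Real.arctan_neg, rescale]
  ring

lemma rescale_inv' {m : ℝ} (hm : 0 < m) (x : ℝ) : rescale m (rescale m⁻¹ x) = x := by
  simpa using rescale_inv (inv_pos.2 hm) x

lemma rescale_add_two_pi (m x : ℝ) :
    rescale m (x + 2 * Real.pi) = rescale m x + 2 * Real.pi := by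
  have h : (x + 2 * Real.pi) / 2 = x / 2 + Real.pi := by ring
  simp only [rescale, h, Real.sin_add_pi, Real.cos_add_pi, neg_mul_neg, neg_sq]
  ring

lemma continuous_rescale {X : Type*} [TopologicalSpace X] {m g : X → ℝ} (hm : Continuous m)
    (hg : Continuous g) (h : ∀ x, 0 < m x) : Continuous fun x => rescale (m x) (g x) := by
  unfold rescale
  refine hg.add (continuous_const.mul (Real.continuous_arctan.comp (Continuous.div ?_ ?_ ?_)))
  · fun_prop
  · fun_prop
  · exact fun x => (rescale_den_pos (h x) (g x)).ne'

lemma rescale_strictMono {m : ℝ} (hm : 0 < m) : StrictMono (rescale m) := by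
  have hinj : Function.Injective (rescale m) := Function.LeftInverse.injective (rescale_inv hm)
  have hcont : Continuous (rescale m) :=
    continuous_rescale (m := fun _ => m) continuous_const continuous_id fun _ => hm
  rcases hcont.strictMono_of_inj hinj with h | h
  · exact h
  · have h1 := h (show (0 : ℝ) < 0 + 2 * Real.pi by linarith [Real.pi_pos])
    rw [rescale_add_two_pi] at h1
    linarith [Real.pi_pos]

/-- The coordinate `Ũ`, with `tan (Ũ/2) = √k tan (ũ/2)`. -/
def Cover.U (x : Cover) : ℝ := rescale (Real.sqrt x.k) x.u

/-- The coordinate `Ṽ`, with `tan (Ṽ/2) = √k tan (ṽ/2)`. -/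
def Cover.V (x : Cover) : ℝ := rescale (Real.sqrt x.k) x.v

/-- The translation `(p, k, Ũ, Ṽ) ↦ (p, k, Ũ + c, Ṽ + c)`. -/
def translate (c : ℝ) (x : Cover) : Cover :=
  ⟨(x.p, x.k, rescale (Real.sqrt x.k)⁻¹ (x.U + c), rescale (Real.sqrt x.k)⁻¹ (x.V + c)),
    x.p_pos, ⟨x.k_pos, x.k_lt_one⟩, by
      have hk := Real.sqrt_pos.2 x.k_pos
      exact rescale_strictMono (inv_pos.2 hk)
        (by linarith [rescale_strictMono hk x.u_lt_v, Cover.U.eq_1 x, Cover.V.eq_1 x]), by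
      have hk := Real.sqrt_pos.2 x.k_pos
      have h := rescale_strictMono hk x.v_lt
      rw [rescale_add_two_pi] at h
      change rescale _ _ < rescale _ _ + 2 * Real.pi
      rw [← rescale_add_two_pi]
      exact rescale_strictMono (inv_pos.2 hk) (by unfold Cover.U Cover.V; linarith)⟩

lemma translate_U (c : ℝ) (x : Cover) : (translate c x).U = x.U + c :=
  rescale_inv' (Real.sqrt_pos.2 x.k_pos) _

lemma translate_V (c : ℝ) (x : Cover) : (translate c x).V = x.V + c :=
  rescale_inv' (Real.sqrt_pos.2 x.k_pos) _

lemma translate_neg (c : ℝ) (x : Cover) : translate (-c) (translate c x) = x := by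
  have hk := Real.sqrt_pos.2 x.k_pos
  apply Subtype.ext
  change (x.p, x.k, rescale (Real.sqrt x.k)⁻¹ ((translate c x).U + -c),
    rescale (Real.sqrt x.k)⁻¹ ((translate c x).V + -c)) = (x.p, x.k, x.u, x.v)
  rw [translate_U, translate_V, add_neg_cancel_right, add_neg_cancel_right, Cover.U, Cover.V,
    rescale_inv hk, rescale_inv hk]

lemma continuous_translate (c : ℝ) : Continuous (translate c) := by
  have hp : Continuous Cover.p := by unfold Cover.p; fun_prop
  have hk : Continuous Cover.k := by unfold Cover.k; fun_prop
  have hu : Continuous Cover.u := by unfold Cover.u; fun_prop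
  have hv : Continuous Cover.v := by unfold Cover.v; fun_prop
  have hs : Continuous fun x : Cover => Real.sqrt x.k := hk.sqrt
  have hs0 : ∀ x : Cover, 0 < Real.sqrt x.k := fun x => Real.sqrt_pos.2 x.k_pos
  have hi : Continuous fun x : Cover => (Real.sqrt x.k)⁻¹ := hs.inv₀ fun x => (hs0 x).ne'
  have hU : Continuous Cover.U := continuous_rescale hs hu hs0
  have hV : Continuous Cover.V := continuous_rescale hs hv hs0
  refine Continuous.subtype_mk (hp.prodMk (hk.prodMk (Continuous.prodMk ?_ ?_))) _
  · exact continuous_rescale hi (hU.add continuous_const) fun x => inv_pos.2 (hs0 x)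
  · exact continuous_rescale hi (hV.add continuous_const) fun x => inv_pos.2 (hs0 x)

/-- The deck transformation `λ̃ : (p, k, Ũ, Ṽ) ↦ (p, k, Ũ + π, Ṽ + π)`, a homeomorphism of the
universal cover. -/
def deck : Cover ≃ₜ Cover where
  toFun := translate Real.pi
  invFun := translate (-Real.pi)
  left_inv := translate_neg Real.pi
  right_inv x := by simpa using translate_neg (-Real.pi) x
  continuous_toFun := continuous_translate _
  continuous_invFun := continuous_translate _

/-! ### The charts of the level sets of `S` -/

/-- The subset of the universal cover on which `S = p`. -/
def levelSet (p : ℝ) : Set Cover := {x | S (proj x) = p}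

/-- The coordinates `(q, k, Ũ)`, `q = T̃`, used when `p ≤ 1`. -/
def chartU (x : Cover) : ℝ × Set.Ioo (0 : ℝ) 1 × ℝ :=
  (liftedT x, ⟨x.k, x.k_pos, x.k_lt_one⟩, x.U)

/-- The coordinates `(q, k, Ṽ)`, `q = T̃`, used when `p ≥ 1`. -/
def chartV (x : Cover) : ℝ × Set.Ioo (0 : ℝ) 1 × ℝ :=
  (liftedT x, ⟨x.k, x.k_pos, x.k_lt_one⟩, x.V)

end GenusOne

end

open scoped ComplexConjugate

noncomputable section

namespace GenusOne

/-! On `u = tan (ũ/2)` and `v = tan (ṽ/2)` the deck transformation is `t ↦ -1/(k t)`. This is the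
boundary action of `z ↦ 1/(k z)`, an automorphism of the right half-plane that exchanges `1` and
`1/k`. The base point moves accordingly, to `1/(k z₀)` (`zZero_deck`), so precomposing `f⁻¹` with
this automorphism exchanges `α` and `β` (`fInv_deck`, `proj_deck`).

The map `f⁻¹` sends `i u` to `1` and `i v` to `-1`. Writing `1 - f⁻¹` and `1 + f⁻¹` with these zeros
shows `S = p` on the cover (`S_proj`), and the deck transformation preserves `p`.

For `T̃`, the form `dx/δ` is invariant, so `F̃` changes by the constant `F̃(π) = K'`. `Ẽ` changes by
`K' - E'` plus an algebraic correction, and the boundary term changes by the same correction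
(`liftedF_deckLift`, `liftedE_deckLift`, `boundaryTerm_deckLift`). The corrections cancel in `T̃`,
leaving `4 (p - 1) (E K' - K (K' - E')) / (2π)`. Legendre's relation evaluates the last bracket as
`π/2`, so the change is `p - 1`. That relation is proved by showing that its left side has zero
derivative in `m = k²` and tends to `π/2` as `m → 0⁺`. -/

lemma delta_sq (k x : ℝ) :
    delta k x ^ 2 = Real.cos (x / 2) ^ 2 + k ^ 2 * Real.sin (x / 2) ^ 2 :=
  Real.sq_sqrt (by positivity)

/-! ### The deck transformation on one boundary coordinate -/

/-- The lift to `ℝ` of the map `tan (x/2) ↦ -1 / (k tan (x/2))` through which the deck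
transformation acts on the coordinates `ũ` and `ṽ`. -/
def deckLift (k x : ℝ) : ℝ :=
  rescale (Real.sqrt k)⁻¹ (rescale (Real.sqrt k) x + Real.pi)

lemma deck_p (x : Cover) : (deck x).p = x.p := rfl
lemma deck_k (x : Cover) : (deck x).k = x.k := rfl
lemma deck_u (x : Cover) : (deck x).u = deckLift x.k x.u := rfl
lemma deck_v (x : Cover) : (deck x).v = deckLift x.k x.v := rfl

lemma deckLift_zero (k : ℝ) : deckLift k 0 = Real.pi := by
  simp [deckLift, rescale]

/-- Up to positive factors, the half-angle vector `(c, s)` goes to `(c, √k s)`, then by a quarter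
turn to `(-√k s, c)`, then to a multiple of `(-k s, c)`. Positivity of the factors keeps the signs,
which the tangent alone would lose, and no point has to be treated as infinite. -/
lemma half_deckLift {k : ℝ} (hk : 0 < k) (x : ℝ) :
    Real.cos (deckLift k x / 2) = -(k * Real.sin (x / 2)) / delta k x ∧
    Real.sin (deckLift k x / 2) = Real.cos (x / 2) / delta k x := by
  have hm := Real.sqrt_pos.2 hk
  have hmm : Real.sqrt k ^ 2 = k := Real.sq_sqrt hk.le
  have hd := delta_pos hk x
  have hd2 := delta_sq k x
  obtain ⟨r, hr, hc, hs⟩ := rescale_half hm x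
  obtain ⟨q, hq, hc', hs'⟩ :=
    rescale_half (inv_pos.2 hm) (rescale (Real.sqrt k) x + Real.pi)
  have e : (rescale (Real.sqrt k) x + Real.pi) / 2
      = rescale (Real.sqrt k) x / 2 + Real.pi / 2 := by ring
  rw [e, Real.cos_add_pi_div_two, hs] at hc'
  rw [e, Real.sin_add_pi_div_two, hc] at hs'
  change Real.cos (deckLift k x / 2) = _ at hc'
  change Real.sin (deckLift k x / 2) = _ at hs'
  set m := Real.sqrt k
  have h1 := Real.sin_sq_add_cos_sq (deckLift k x / 2)
  -- The image is a unit vector and the factor is positive, so normalisation determines it.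
  have hρ : q * r / m = 1 / delta k x := by
    rw [eq_div_iff hd.ne']
    have h0 : 0 < q * r / m * delta k x := by positivity
    have : (q * r / m * delta k x) ^ 2 = 1 := by
      rw [mul_pow, hd2, ← h1, hc', hs', ← hmm]
      field_simp
    nlinarith
  constructor
  · rw [hc', show -(k * Real.sin (x / 2)) / delta k x
      = -(k * Real.sin (x / 2)) * (1 / delta k x) by ring, ← hρ]
    field_simp
    linear_combination (-Real.sin (x / 2)) * hmm
  · rw [hs', show Real.cos (x / 2) / delta k x
      = Real.cos (x / 2) * (1 / delta k x) by ring, ← hρ]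
    field_simp

lemma cos_half_deckLift {k : ℝ} (hk : 0 < k) (x : ℝ) :
    Real.cos (deckLift k x / 2) = -(k * Real.sin (x / 2)) / delta k x := (half_deckLift hk x).1

lemma sin_half_deckLift {k : ℝ} (hk : 0 < k) (x : ℝ) :
    Real.sin (deckLift k x / 2) = Real.cos (x / 2) / delta k x := (half_deckLift hk x).2

lemma delta_deckLift {k : ℝ} (hk : 0 < k) (x : ℝ) :
    delta k (deckLift k x) = k / delta k x := by
  have hd := delta_pos hk x
  have h1 := Real.sin_sq_add_cos_sq (x / 2)
  rw [delta, cos_half_deckLift hk, sin_half_deckLift hk,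
    Real.sqrt_eq_iff_mul_self_eq (by positivity) (by positivity)]
  field_simp
  linear_combination h1

lemma sin_half_sub_deckLift {k : ℝ} (hk : 0 < k) (x y : ℝ) :
    Real.sin ((deckLift k x - deckLift k y) / 2)
      = k * Real.sin ((x - y) / 2) / (delta k x * delta k y) := by
  have hx := delta_pos hk x
  have hy := delta_pos hk y
  rw [sub_div, Real.sin_sub, sub_div, Real.sin_sub, cos_half_deckLift hk, cos_half_deckLift hk,
    sin_half_deckLift hk, sin_half_deckLift hk]
  field_simp
  ring

lemma hasDerivAt_half_sin (x : ℝ) :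
    HasDerivAt (fun x : ℝ => Real.sin (x / 2)) (Real.cos (x / 2) / 2) x := by
  simpa [div_eq_mul_inv] using ((hasDerivAt_id x).div_const 2).sin

lemma hasDerivAt_half_cos (x : ℝ) :
    HasDerivAt (fun x : ℝ => Real.cos (x / 2)) (-Real.sin (x / 2) / 2) x := by
  simpa [div_eq_mul_inv] using ((hasDerivAt_id x).div_const 2).cos

lemma hasDerivAt_rescale {m : ℝ} (hm : 0 < m) (x : ℝ) :
    HasDerivAt (rescale m)
      (m / (Real.cos (x / 2) ^ 2 + m ^ 2 * Real.sin (x / 2) ^ 2)) x := by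
  have hN := rescale_den_pos hm x
  have hs := hasDerivAt_half_sin x
  have hc := hasDerivAt_half_cos x
  have h1 := Real.sin_sq_add_cos_sq (x / 2)
  have hM := rescale_den_pos (pow_pos hm 2) x
  have h := (hasDerivAt_id x).add ((((hs.mul hc).const_mul (m - 1)).div
    ((hc.fun_pow 2).fun_add ((hs.fun_pow 2).const_mul m)) hN.ne').arctan.const_mul 2)
  refine h.congr_deriv ?_
  simp only [Pi.mul_apply, Pi.div_apply]
  set s := Real.sin (x / 2)
  set c := Real.cos (x / 2)
  have hq : 1 + ((m - 1) * (s * c) / (c ^ 2 + m * s ^ 2)) ^ 2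
      = (c ^ 2 + m ^ 2 * s ^ 2) / (c ^ 2 + m * s ^ 2) ^ 2 := by
    field_simp
    linear_combination (c ^ 2 + m ^ 2 * s ^ 2) * h1
  rw [hq]
  field_simp
  push_cast
  have h2 : c ^ 2 = 1 - s ^ 2 := by linarith
  ring_nf
  simp only [show c ^ 4 = (c ^ 2) ^ 2 by ring, h2]
  ring

/-- Together with `delta_deckLift` this value makes `dx/δ` an invariant form. -/
lemma hasDerivAt_deckLift {k : ℝ} (hk : 0 < k) (x : ℝ) :
    HasDerivAt (deckLift k) (k / delta k x ^ 2) x := by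
  have hm := Real.sqrt_pos.2 hk
  have hmm : Real.sqrt k ^ 2 = k := Real.sq_sqrt hk.le
  have hd := delta_pos hk x
  have hd2 := delta_sq k x
  have hN := rescale_den_pos hk x
  obtain ⟨r, hr, hc, hs⟩ := rescale_half hm x
  have e : (rescale (Real.sqrt k) x + Real.pi) / 2
      = rescale (Real.sqrt k) x / 2 + Real.pi / 2 := by ring
  have h := (hasDerivAt_rescale (inv_pos.2 hm) (rescale (Real.sqrt k) x + Real.pi)).comp x
    ((hasDerivAt_rescale hm x).add_const Real.pi)
  refine h.congr_deriv ?_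
  rw [e, Real.cos_add_pi_div_two, Real.sin_add_pi_div_two]
  have h1 := Real.sin_sq_add_cos_sq (rescale (Real.sqrt k) x / 2)
  rw [hc, hs] at h1 ⊢
  set m := Real.sqrt k
  have hA : (-(r * (m * Real.sin (x / 2)))) ^ 2 + m⁻¹ ^ 2 * (r * Real.cos (x / 2)) ^ 2
      = r ^ 2 * delta k x ^ 2 / m ^ 2 := by
    rw [hd2, ← hmm]; field_simp; ring
  have hr2 : Real.cos (x / 2) ^ 2 + m ^ 2 * Real.sin (x / 2) ^ 2 = 1 / r ^ 2 := by
    field_simp; linear_combination h1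
  rw [hA, hr2, ← hmm]
  field_simp

/-! ### The deck transformation lifts the swap -/

lemma zDen_deck {k : ℝ} (hk : 0 < k) (p u v : ℝ) :
    zDen p k (deckLift k u) (deckLift k v) = k ^ 3 * (p * delta k v * Real.sin (u / 2) ^ 2
      + delta k u * Real.sin (v / 2) ^ 2) / (delta k u * delta k v) ^ 2 := by
  have hu := delta_pos hk u
  have hv := delta_pos hk v
  rw [zDen, delta_deckLift hk, delta_deckLift hk, cos_half_deckLift hk, cos_half_deckLift hk]
  field_simp

lemma zZero_ne (x : Cover) : zZero x.p x.k x.u x.v ≠ 0 := fun h =>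
  x.zZero_re_pos.ne' (by rw [h]; rfl)

lemma zZero_sq_mul (x : Cover) :
    (Real.sqrt (x.p * delta x.k x.u * delta x.k x.v) * |Real.sin ((x.u - x.v) / 2)|) ^ 2
      = x.p * delta x.k x.u * delta x.k x.v * (Real.sin (x.u / 2) * Real.cos (x.v / 2)
        - Real.cos (x.u / 2) * Real.sin (x.v / 2)) ^ 2 := by
  have hu := delta_pos x.k_pos x.u
  have hv := delta_pos x.k_pos x.v
  have hp := x.p_pos
  rw [mul_pow, sq_abs, Real.sq_sqrt (by positivity), sub_div, Real.sin_sub]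

/-- Write `z₀ = (R + i M)/D`. Then `R² + M² = D Q`, where `Q` is `D` with cosines replaced by sines.
Hence `|z₀|² = Q/D` and `1/(k z₀) = (R - i M)/(k Q)`, which is what the half-angle formulas give. -/
lemma zZero_deck (x : Cover) :
    zZero x.p x.k (deckLift x.k x.u) (deckLift x.k x.v)
      = ((x.k : ℂ) * zZero x.p x.k x.u x.v)⁻¹ := by
  have hk := x.k_pos
  have hu := delta_pos hk x.u
  have hv := delta_pos hk x.v
  have hp := x.p_pos
  have hD := x.zDen_pos
  have hD' := (deck x).zDen_pos
  rw [deck_p, deck_k, deck_u, deck_v, zDen_deck hk] at hD'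
  have hR := zZero_sq_mul x
  have hre : Real.sqrt (x.p * (x.k / delta x.k x.u) * (x.k / delta x.k x.v))
      = x.k * Real.sqrt (x.p * delta x.k x.u * delta x.k x.v)
        / (delta x.k x.u * delta x.k x.v) := by
    rw [Real.sqrt_eq_iff_mul_self_eq (by positivity) (by positivity)]
    have := Real.mul_self_sqrt (show 0 ≤ x.p * delta x.k x.u * delta x.k x.v by positivity)
    field_simp
    rw [pow_two, this]
  -- Up to a positive factor this is the denominator at the image point, already known to be
  -- positive.
  have hQ : 0 < x.p * delta x.k x.v * Real.sin (x.u / 2) ^ 2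
      + delta x.k x.u * Real.sin (x.v / 2) ^ 2 := by
    by_contra hcon
    exact absurd hD' (not_lt.2 (div_nonpos_of_nonpos_of_nonneg
      (mul_nonpos_of_nonneg_of_nonpos (by positivity) (not_lt.1 hcon)) (by positivity)))
  have hz : zZero x.p x.k (deckLift x.k x.u) (deckLift x.k x.v) =
      ⟨Real.sqrt (x.p * delta x.k x.u * delta x.k x.v) * |Real.sin ((x.u - x.v) / 2)|
        / (x.k * (x.p * delta x.k x.v * Real.sin (x.u / 2) ^ 2
          + delta x.k x.u * Real.sin (x.v / 2) ^ 2)),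
       -(x.p * Real.sin (x.u / 2) * Real.cos (x.u / 2) * delta x.k x.v
        + Real.sin (x.v / 2) * Real.cos (x.v / 2) * delta x.k x.u)
        / (x.k * (x.p * delta x.k x.v * Real.sin (x.u / 2) ^ 2
          + delta x.k x.u * Real.sin (x.v / 2) ^ 2))⟩ := by
    rw [zZero, zDen_deck hk, delta_deckLift hk, delta_deckLift hk, sin_half_sub_deckLift hk,
      abs_div, abs_mul, abs_of_pos hk, abs_of_pos (mul_pos hu hv), hre,
      cos_half_deckLift hk, cos_half_deckLift hk, sin_half_deckLift hk, sin_half_deckLift hk]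
    generalize hQ' : x.p * delta x.k x.v * Real.sin (x.u / 2) ^ 2
          + delta x.k x.u * Real.sin (x.v / 2) ^ 2 = Q at *
    congr 1 <;> field_simp
    ring
  apply eq_inv_of_mul_eq_one_left
  rw [hz, zZero]
  generalize Real.sqrt (x.p * delta x.k x.u * delta x.k x.v) * |Real.sin ((x.u - x.v) / 2)|
    = R at hR ⊢
  have hM : R ^ 2 + (x.p * Real.sin (x.u / 2) * Real.cos (x.u / 2) * delta x.k x.v
        + Real.sin (x.v / 2) * Real.cos (x.v / 2) * delta x.k x.u) ^ 2
      = zDen x.p x.k x.u x.v * (x.p * delta x.k x.v * Real.sin (x.u / 2) ^ 2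
        + delta x.k x.u * Real.sin (x.v / 2) ^ 2) := by
    rw [hR, zDen]; ring
  generalize x.p * delta x.k x.v * Real.sin (x.u / 2) ^ 2
          + delta x.k x.u * Real.sin (x.v / 2) ^ 2 = Q at *
  generalize zDen x.p x.k x.u x.v = D at *
  generalize x.p * Real.sin (x.u / 2) * Real.cos (x.u / 2) * delta x.k x.v
        + Real.sin (x.v / 2) * Real.cos (x.v / 2) * delta x.k x.u = M at *
  apply Complex.ext
  · simp
    field_simp
    linear_combination hM
  · simp
    field_simp
    ring

/-- The automorphism `z ↦ 1/(k z)` of the half-plane carries `z₀` and `i u` to their counterparts at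
the image point, and these normalise `f⁻¹`. The values `t = 1` and `t = 1/k` give the swap. -/
lemma fInv_deck (x : Cover) {t : ℝ} (ht : 0 < t) :
    fInv x.p x.k (deckLift x.k x.u) (deckLift x.k x.v) (t : ℂ)
      = fInv x.p x.k x.u x.v (((x.k * t)⁻¹ : ℝ) : ℂ) := by
  have hk := x.k_pos
  have hu := delta_pos hk x.u
  have h1 := (deck x).norm_fInv_pre
  have h2 := x.norm_fInv_pre
  have h3 := (deck x).add_conj_ne ht
  have h4 := x.add_conj_ne (inv_pos.2 (mul_pos hk ht))
  have hz := zZero_ne x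
  have hcz : conj (zZero x.p x.k x.u x.v) ≠ 0 := (map_ne_zero _).2 hz
  have hkC : (x.k : ℂ) ≠ 0 := by exact_mod_cast hk.ne'
  have htC : (t : ℂ) ≠ 0 := by exact_mod_cast ht.ne'
  have huC : (delta x.k x.u : ℂ) ≠ 0 := by exact_mod_cast hu.ne'
  rw [deck_p, deck_k, deck_u, deck_v] at h1 h3
  unfold fInv
  have hd1 := (div_ne_zero_iff.1 (norm_ne_zero_iff.1 (h1.trans_ne one_ne_zero))).2
  have hd2 := (div_ne_zero_iff.1 (norm_ne_zero_iff.1 (h2.trans_ne one_ne_zero))).2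
  rw [div_mul_div_comm, div_mul_div_comm, div_eq_div_iff (mul_ne_zero hd1 h3)
    (mul_ne_zero hd2 h4)]
  rw [zZero_deck, sin_half_deckLift hk, cos_half_deckLift hk]
  simp only [map_inv₀, map_mul, Complex.conj_ofReal]
  -- From here `z₀` and its conjugate are independent variables; besides nonvanishing, only `I² =
  -- -1` enters the identity.
  generalize zZero x.p x.k x.u x.v = z at *
  generalize conj z = w at *
  generalize Real.sin (x.u / 2) = s at *
  generalize Real.cos (x.u / 2) = c at *
  push_cast
  have hI : Complex.I ^ 2 = -1 := Complex.I_sq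
  field_simp
  linear_combination (x.k * t * z - 1) * (x.k * w * t + 1) * (c * s * (w + z)) * hI

theorem proj_deck (x : Cover) : proj (deck x) = swap (proj x) := by
  have hk := x.k_pos
  apply Subtype.ext
  refine Prod.ext ?_ ?_
  · exact (fInv_deck x one_pos).trans (by rw [mul_one]; rfl)
  · refine (fInv_deck x (inv_pos.2 hk)).trans ?_
    rw [mul_inv_cancel₀ hk.ne', inv_one]; rfl

/-! ### The value of `S` on the cover -/

/-- `f⁻¹` sends the boundary point `i u` to `1`, expressed through
`(1 - f⁻¹(t)) (i u - z₀) (t + z̄₀) = (i u - t) (z₀ + z̄₀)`. -/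
lemma one_sub_fInv (x : Cover) {t : ℝ} (ht : 0 < t) :
    (1 - fInv x.p x.k x.u x.v (t : ℂ)) *
      ((Complex.I * (Real.sin (x.u / 2) : ℂ)
        - zZero x.p x.k x.u x.v * (Real.cos (x.u / 2) : ℂ)) *
        (t + conj (zZero x.p x.k x.u x.v)))
      = (Complex.I * (Real.sin (x.u / 2) : ℂ) - t * (Real.cos (x.u / 2) : ℂ)) *
        (zZero x.p x.k x.u x.v + conj (zZero x.p x.k x.u x.v)) := by
  have h2 := x.norm_fInv_pre
  have hd2 := (div_ne_zero_iff.1 (norm_ne_zero_iff.1 (h2.trans_ne one_ne_zero))).2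
  have h4 := x.add_conj_ne ht
  unfold fInv
  rw [div_mul_div_comm, sub_mul, div_mul_cancel₀ _ (mul_ne_zero hd2 h4)]
  ring

/-- This is `f⁻¹(i v) = -1` with denominators cleared. Geometrically, `z₀` sees `i u` and `i v` at a
right angle: it lies on the geodesic joining them. The imaginary part vanishes identically; the real
part is the formula for `(Re z₀)²`. -/
lemma zZero_boundary (x : Cover) :
    (Complex.I * (Real.sin (x.u / 2) : ℂ)
        + conj (zZero x.p x.k x.u x.v) * (Real.cos (x.u / 2) : ℂ)) *
      (Complex.I * (Real.sin (x.v / 2) : ℂ)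
        - zZero x.p x.k x.u x.v * (Real.cos (x.v / 2) : ℂ)) +
    (Complex.I * (Real.sin (x.u / 2) : ℂ)
        - zZero x.p x.k x.u x.v * (Real.cos (x.u / 2) : ℂ)) *
      (Complex.I * (Real.sin (x.v / 2) : ℂ)
        + conj (zZero x.p x.k x.u x.v) * (Real.cos (x.v / 2) : ℂ)) = 0 := by
  have hR := zZero_sq_mul x
  have hD := x.zDen_pos
  unfold zZero
  rw [zDen] at *
  generalize Real.sqrt (x.p * delta x.k x.u * delta x.k x.v) * |Real.sin ((x.u - x.v) / 2)|
    = R at hR ⊢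
  generalize Real.sin (x.u / 2) = s at *
  generalize Real.cos (x.u / 2) = c at *
  generalize Real.sin (x.v / 2) = s' at *
  generalize Real.cos (x.v / 2) = c' at *
  apply Complex.ext
  · simp
    field_simp
    linear_combination (-2 * c * c') * hR
  · simp
    ring

/-- `f⁻¹` sends the boundary point `i v` to `-1`. -/
lemma one_add_fInv (x : Cover) {t : ℝ} (ht : 0 < t) :
    (1 + fInv x.p x.k x.u x.v (t : ℂ)) *
      ((Complex.I * (Real.sin (x.v / 2) : ℂ)
        - zZero x.p x.k x.u x.v * (Real.cos (x.v / 2) : ℂ)) *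
        (t + conj (zZero x.p x.k x.u x.v)))
      = (Complex.I * (Real.sin (x.v / 2) : ℂ) - t * (Real.cos (x.v / 2) : ℂ)) *
        (zZero x.p x.k x.u x.v + conj (zZero x.p x.k x.u x.v)) := by
  have h2 := x.norm_fInv_pre
  have hd2 := (div_ne_zero_iff.1 (norm_ne_zero_iff.1 (h2.trans_ne one_ne_zero))).2
  have h4 := x.add_conj_ne ht
  have hb := zZero_boundary x
  unfold fInv
  generalize conj (zZero x.p x.k x.u x.v) = w at *
  generalize zZero x.p x.k x.u x.v = z at *
  generalize (Real.sin (x.u / 2) : ℂ) = s at *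
  generalize (Real.cos (x.u / 2) : ℂ) = c at *
  rw [div_mul_div_comm, one_add_div (mul_ne_zero hd2 h4), div_mul_eq_mul_div,
    div_eq_iff (mul_ne_zero hd2 h4)]
  linear_combination (t - z) * (t + w) * hb

/-- With `normSq_sub_zZero_v`, this locates `z₀` on the geodesic: the quotient of the two squared
distances, in homogeneous form, is where `p` enters `S`. -/
lemma normSq_sub_zZero_u (x : Cover) :
    Complex.normSq (Complex.I * (Real.sin (x.u / 2) : ℂ)
        - zZero x.p x.k x.u x.v * (Real.cos (x.u / 2) : ℂ))
      = Real.sin ((x.u - x.v) / 2) ^ 2 * delta x.k x.u / zDen x.p x.k x.u x.v := by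
  have hR := zZero_sq_mul x
  have hD := x.zDen_pos
  rw [Complex.normSq_apply, sub_div, Real.sin_sub]
  unfold zZero
  rw [zDen] at *
  generalize Real.sqrt (x.p * delta x.k x.u * delta x.k x.v) * |Real.sin ((x.u - x.v) / 2)|
    = R at hR ⊢
  generalize Real.sin (x.u / 2) = s at *
  generalize Real.cos (x.u / 2) = c at *
  generalize Real.sin (x.v / 2) = s' at *
  generalize Real.cos (x.v / 2) = c' at *
  simp
  field_simp
  linear_combination c ^ 2 * hR

lemma normSq_sub_zZero_v (x : Cover) :
    Complex.normSq (Complex.I * (Real.sin (x.v / 2) : ℂ)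
        - zZero x.p x.k x.u x.v * (Real.cos (x.v / 2) : ℂ))
      = Real.sin ((x.u - x.v) / 2) ^ 2 * (x.p * delta x.k x.v) / zDen x.p x.k x.u x.v := by
  have hR := zZero_sq_mul x
  have hD := x.zDen_pos
  rw [Complex.normSq_apply, sub_div, Real.sin_sub]
  unfold zZero
  rw [zDen] at *
  generalize Real.sqrt (x.p * delta x.k x.u * delta x.k x.v) * |Real.sin ((x.u - x.v) / 2)|
    = R at hR ⊢
  generalize Real.sin (x.u / 2) = s at *
  generalize Real.cos (x.u / 2) = c at *
  generalize Real.sin (x.v / 2) = s' at *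
  generalize Real.cos (x.v / 2) = c' at *
  simp
  field_simp
  linear_combination c' ^ 2 * hR

lemma norm_boundary_sub (y t : ℝ) :
    ‖Complex.I * (Real.sin (y / 2) : ℂ) - t * (Real.cos (y / 2) : ℂ)‖
      = Real.sqrt (Real.sin (y / 2) ^ 2 + t ^ 2 * Real.cos (y / 2) ^ 2) := by
  rw [Complex.norm_def, Complex.normSq_apply]
  congr 1
  generalize Real.sin (y / 2) = s
  generalize Real.cos (y / 2) = c
  simp
  ring

lemma norm_boundary_sub_inv {k : ℝ} (hk : 0 < k) (y : ℝ) :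
    ‖Complex.I * (Real.sin (y / 2) : ℂ) - ((k⁻¹ : ℝ) : ℂ) * (Real.cos (y / 2) : ℂ)‖
      = delta k y / k := by
  rw [norm_boundary_sub, Real.sqrt_eq_iff_mul_self_eq (by positivity)
    (div_nonneg (delta_pos hk y).le hk.le), ← pow_two, div_pow, delta_sq]
  field_simp
  ring

lemma norm_boundary_sub_one (y : ℝ) :
    ‖Complex.I * (Real.sin (y / 2) : ℂ) - ((1 : ℝ) : ℂ) * (Real.cos (y / 2) : ℂ)‖ = 1 := by
  rw [norm_boundary_sub, one_pow, one_mul, Real.sin_sq_add_cos_sq, Real.sqrt_one]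

/-- In the quotient the factors `t + z̄₀` and `z₀ + z̄₀` cancel. The distances from `i u` and `i v`
to `1` and `1/k` contribute `δ(ũ)/δ(ṽ)`, and those to `z₀` contribute `p δ(ṽ)/δ(ũ)`. -/
theorem S_proj (x : Cover) : S (proj x) = x.p := by
  have hk := x.k_pos
  have hu := delta_pos hk x.u
  have hv := delta_pos hk x.v
  have hp := x.p_pos
  have hD := x.zDen_pos
  have hs := x.sin_ne
  have a1 := congrArg norm (one_sub_fInv x one_pos)
  have a2 := congrArg norm (one_sub_fInv x (inv_pos.2 hk))
  have b1 := congrArg norm (one_add_fInv x one_pos)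
  have b2 := congrArg norm (one_add_fInv x (inv_pos.2 hk))
  have c1 := norm_pos_iff.2 (x.add_conj_ne one_pos)
  have c2 := norm_pos_iff.2 (x.add_conj_ne (inv_pos.2 hk))
  have d : 0 < ‖zZero x.p x.k x.u x.v + conj (zZero x.p x.k x.u x.v)‖ := by
    rw [Complex.add_conj]
    have := x.zZero_re_pos
    exact norm_pos_iff.2 (by exact_mod_cast (by positivity : 2 * (zZero x.p x.k x.u x.v).re ≠ 0))
  have e1 := normSq_sub_zZero_u x
  have e2 := normSq_sub_zZero_v x
  simp only [norm_mul, norm_boundary_sub_one, norm_boundary_sub_inv hk, one_mul] at a1 a2 b1 b2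
  rw [← Complex.sq_norm] at e1 e2
  unfold S proj
  simp only
  set U := ‖Complex.I * (Real.sin (x.u / 2) : ℂ)
        - zZero x.p x.k x.u x.v * (Real.cos (x.u / 2) : ℂ)‖
  set V := ‖Complex.I * (Real.sin (x.v / 2) : ℂ)
        - zZero x.p x.k x.u x.v * (Real.cos (x.v / 2) : ℂ)‖
  have hs2 : 0 < Real.sin ((x.u - x.v) / 2) ^ 2 := by positivity
  have hU : 0 < U := by
    have : 0 < U ^ 2 := by rw [e1]; positivity
    exact (norm_nonneg _).lt_of_ne' (pow_ne_zero_iff two_ne_zero |>.1 this.ne')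
  have hV : 0 < V := by
    have : 0 < V ^ 2 := by rw [e2]; positivity
    exact (norm_nonneg _).lt_of_ne' (pow_ne_zero_iff two_ne_zero |>.1 this.ne')
  rw [eq_div_of_mul_eq (by positivity) a1, eq_div_of_mul_eq (by positivity) a2,
    eq_div_of_mul_eq (by positivity) b1, eq_div_of_mul_eq (by positivity) b2]
  generalize ‖(((x.k)⁻¹ : ℝ) : ℂ) + conj (zZero x.p x.k x.u x.v)‖ = C at *
  field_simp
  rw [e1, e2]
  field_simp

/-! ### Legendre's relation -/

open Real Set Filter Topology

lemma one_sub_mul_sin_sq_pos {m : ℝ} (hm : m < 1) (t : ℝ) : 0 < 1 - m * sin t ^ 2 := by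
  rcases (sq_nonneg (sin t)).eq_or_lt with h | h
  · rw [← h]; norm_num
  · nlinarith [sin_sq_le_one t]

/-- The complete elliptic integral of the first kind as a function of the parameter `m = k ^ 2`. -/
def paramK (m : ℝ) : ℝ := ∫ t in (0 : ℝ)..(π / 2), 1 / √(1 - m * sin t ^ 2)

/-- The complete elliptic integral of the second kind as a function of the parameter
`m = k ^ 2`. -/
def paramE (m : ℝ) : ℝ := ∫ t in (0 : ℝ)..(π / 2), √(1 - m * sin t ^ 2)

lemma continuous_sqrt_one_sub (m : ℝ) : Continuous fun t => √(1 - m * sin t ^ 2) := by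
  fun_prop

lemma continuous_inv_sqrt_one_sub {m : ℝ} (hm : m < 1) :
    Continuous fun t => 1 / √(1 - m * sin t ^ 2) :=
  continuous_const.div (continuous_sqrt_one_sub m)
    fun t => (sqrt_pos.2 (one_sub_mul_sin_sq_pos hm t)).ne'

lemma continuous_sin_sq_div {m : ℝ} (hm : m < 1) :
    Continuous fun t => sin t ^ 2 / √(1 - m * sin t ^ 2) :=
  (by fun_prop : Continuous fun t => sin t ^ 2).div (continuous_sqrt_one_sub m)
    fun t => (sqrt_pos.2 (one_sub_mul_sin_sq_pos hm t)).ne'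

lemma continuous_sin_sq_div_cube {m : ℝ} (hm : m < 1) :
    Continuous fun t => sin t ^ 2 / √(1 - m * sin t ^ 2) ^ 3 :=
  (by fun_prop : Continuous fun t => sin t ^ 2).div ((continuous_sqrt_one_sub m).pow 3)
    fun t => (pow_pos (sqrt_pos.2 (one_sub_mul_sin_sq_pos hm t)) 3).ne'

lemma hasDerivAt_sqrt_param {m : ℝ} (hm : m < 1) (t : ℝ) :
    HasDerivAt (fun m => √(1 - m * sin t ^ 2))
      (-(1 / 2) * (sin t ^ 2 / √(1 - m * sin t ^ 2))) m := by
  have h := (((hasDerivAt_id m).mul_const (sin t ^ 2)).const_sub 1).sqrt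
    (one_sub_mul_sin_sq_pos hm t).ne'
  refine h.congr_deriv ?_
  simp only [id]
  field_simp

lemma hasDerivAt_inv_sqrt_param {m : ℝ} (hm : m < 1) (t : ℝ) :
    HasDerivAt (fun m => 1 / √(1 - m * sin t ^ 2))
      (1 / 2 * (sin t ^ 2 / √(1 - m * sin t ^ 2) ^ 3)) m := by
  have hp := sqrt_pos.2 (one_sub_mul_sin_sq_pos hm t)
  have h := (hasDerivAt_const m (1 : ℝ)).div (hasDerivAt_sqrt_param hm t) hp.ne'
  refine h.congr_deriv ?_
  field_simp
  ring

/-- A bound uniform in `t` and in the parameter below `b < 1`; it supplies the constant dominating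
functions for differentiation under the integral. -/
lemma sqrt_one_sub_le {m b : ℝ} (h0 : 0 < m) (hmb : m < b) (t : ℝ) :
    √(1 - b) ≤ √(1 - m * sin t ^ 2) := by
  apply sqrt_le_sqrt
  nlinarith [sin_sq_add_cos_sq t, sq_nonneg (sin t), sq_nonneg (cos t)]

lemma hasDerivAt_paramE_aux {m : ℝ} (h0 : 0 < m) (h1 : m < 1) :
    HasDerivAt paramE (∫ t in (0 : ℝ)..(π / 2),
      -(1 / 2) * (sin t ^ 2 / √(1 - m * sin t ^ 2))) m := by
  obtain ⟨b, hmb, hb1⟩ := exists_between h1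
  have hb := sqrt_pos.2 (sub_pos.2 hb1)
  refine (intervalIntegral.hasDerivAt_integral_of_dominated_loc_of_deriv_le
    (F := fun m t => √(1 - m * sin t ^ 2))
    (F' := fun m t => -(1 / 2) * (sin t ^ 2 / √(1 - m * sin t ^ 2)))
    (bound := fun _ => 1 / √(1 - b)) (Ioo_mem_nhds h0 hmb) ?_ ?_ ?_ ?_ ?_ ?_).2
  · exact Eventually.of_forall fun x => (continuous_sqrt_one_sub x).aestronglyMeasurable
  · exact (continuous_sqrt_one_sub m).intervalIntegrable _ _
  · exact (continuous_const.mul (continuous_sin_sq_div h1)).aestronglyMeasurable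
  · refine Eventually.of_forall fun t _ x hx => ?_
    have hle := sqrt_one_sub_le hx.1 hx.2 t
    have hs := hb.trans_le hle
    rw [norm_mul, norm_of_nonneg (show 0 ≤ sin t ^ 2 / √(1 - x * sin t ^ 2) by positivity)]
    calc ‖-(1 / 2 : ℝ)‖ * (sin t ^ 2 / √(1 - x * sin t ^ 2))
        ≤ 1 * (1 / √(1 - b)) := by
          gcongr
          · norm_num
          · exact sin_sq_le_one t
      _ = _ := one_mul _
  · exact intervalIntegrable_const
  · exact Eventually.of_forall fun t _ x hx => hasDerivAt_sqrt_param (hx.2.trans hb1) t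

lemma hasDerivAt_paramK_aux {m : ℝ} (h0 : 0 < m) (h1 : m < 1) :
    HasDerivAt paramK (∫ t in (0 : ℝ)..(π / 2),
      1 / 2 * (sin t ^ 2 / √(1 - m * sin t ^ 2) ^ 3)) m := by
  obtain ⟨b, hmb, hb1⟩ := exists_between h1
  have hb := sqrt_pos.2 (sub_pos.2 hb1)
  refine (intervalIntegral.hasDerivAt_integral_of_dominated_loc_of_deriv_le
    (F := fun m t => 1 / √(1 - m * sin t ^ 2))
    (F' := fun m t => 1 / 2 * (sin t ^ 2 / √(1 - m * sin t ^ 2) ^ 3))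
    (bound := fun _ => 1 / √(1 - b) ^ 3) (Ioo_mem_nhds h0 hmb) ?_ ?_ ?_ ?_ ?_ ?_).2
  · filter_upwards [Iio_mem_nhds h1] with x hx
    exact (continuous_inv_sqrt_one_sub hx).aestronglyMeasurable
  · exact (continuous_inv_sqrt_one_sub h1).intervalIntegrable _ _
  · exact (continuous_const.mul (continuous_sin_sq_div_cube h1)).aestronglyMeasurable
  · refine Eventually.of_forall fun t _ x hx => ?_
    have hle := sqrt_one_sub_le hx.1 hx.2 t
    have hs := hb.trans_le hle
    rw [norm_mul, norm_of_nonneg (show 0 ≤ sin t ^ 2 / √(1 - x * sin t ^ 2) ^ 3 by positivity)]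
    calc ‖(1 / 2 : ℝ)‖ * (sin t ^ 2 / √(1 - x * sin t ^ 2) ^ 3)
        ≤ 1 * (1 / √(1 - b) ^ 3) := by
          gcongr
          · norm_num
          · exact sin_sq_le_one t
      _ = _ := one_mul _
  · exact intervalIntegrable_const
  · exact Eventually.of_forall fun t _ x hx => hasDerivAt_inv_sqrt_param (hx.2.trans hb1) t

lemma hasDerivAt_paramE {m : ℝ} (h0 : 0 < m) (h1 : m < 1) :
    HasDerivAt paramE ((paramE m - paramK m) / (2 * m)) m := by
  refine (hasDerivAt_paramE_aux h0 h1).congr_deriv ?_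
  rw [paramE, paramK, ← intervalIntegral.integral_sub
    ((continuous_sqrt_one_sub m).intervalIntegrable _ _)
    ((continuous_inv_sqrt_one_sub h1).intervalIntegrable _ _), ← intervalIntegral.integral_div]
  refine intervalIntegral.integral_congr fun t _ => ?_
  have hs := sqrt_pos.2 (one_sub_mul_sin_sq_pos h1 t)
  have hq := sq_sqrt (one_sub_mul_sin_sq_pos h1 t).le
  generalize √(1 - m * sin t ^ 2) = d at *
  field_simp
  linear_combination -hq

lemma hasDerivAt_sin_mul_cos_div {m : ℝ} (h1 : m < 1) (t : ℝ) :
    HasDerivAt (fun t => sin t * cos t / √(1 - m * sin t ^ 2))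
      ((cos t ^ 2 - sin t ^ 2) / √(1 - m * sin t ^ 2)
        + m * sin t ^ 2 * cos t ^ 2 / √(1 - m * sin t ^ 2) ^ 3) t := by
  have hs := sqrt_pos.2 (one_sub_mul_sin_sq_pos h1 t)
  have h := ((hasDerivAt_sin t).fun_mul (hasDerivAt_cos t)).fun_div
    (((((hasDerivAt_sin t).fun_pow 2).const_mul m).const_sub 1).sqrt
    (one_sub_mul_sin_sq_pos h1 t).ne') hs.ne'
  refine h.congr_deriv ?_
  field_simp
  push_cast
  ring

lemma hasDerivAt_paramK {m : ℝ} (h0 : 0 < m) (h1 : m < 1) :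
    HasDerivAt paramK ((paramE m / (1 - m) - paramK m) / (2 * m)) m := by
  refine (hasDerivAt_paramK_aux h0 h1).congr_deriv ?_
  have h1' := sub_pos.2 h1
  have hA := (continuous_sqrt_one_sub m).intervalIntegrable (μ := MeasureTheory.volume) 0 (π / 2)
  have hB := (continuous_inv_sqrt_one_sub h1).intervalIntegrable
    (μ := MeasureTheory.volume) 0 (π / 2)
  have hC := (continuous_sin_sq_div_cube h1).intervalIntegrable
    (μ := MeasureTheory.volume) 0 (π / 2)
  have hpt : ∀ t, (cos t ^ 2 - sin t ^ 2) / √(1 - m * sin t ^ 2)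
        + m * sin t ^ 2 * cos t ^ 2 / √(1 - m * sin t ^ 2) ^ 3
      = (√(1 - m * sin t ^ 2) - (1 - m) * (1 / √(1 - m * sin t ^ 2)))/ m
        - (1 - m) * (sin t ^ 2 / √(1 - m * sin t ^ 2) ^ 3) := fun t => by
    have hs := sqrt_pos.2 (one_sub_mul_sin_sq_pos h1 t)
    have hq := sq_sqrt (one_sub_mul_sin_sq_pos h1 t).le
    have hc := cos_sq' t
    generalize √(1 - m * sin t ^ 2) = d at *
    field_simp
    rw [hq, hc]
    ring
  -- The integrand is the derivative of `sin t cos t / √(1 - m sin² t)`, which vanishes at both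
  -- ends. This expresses the integral with the cubed root through `paramE` and `paramK`.
  have hint : ∫ t in (0 : ℝ)..(π / 2), ((√(1 - m * sin t ^ 2)
      - (1 - m) * (1 / √(1 - m * sin t ^ 2))) / m
        - (1 - m) * (sin t ^ 2 / √(1 - m * sin t ^ 2) ^ 3)) = 0 := by
    rw [intervalIntegral.integral_eq_sub_of_hasDerivAt
      (f := fun t => sin t * cos t / √(1 - m * sin t ^ 2))
      (fun t _ => (hasDerivAt_sin_mul_cos_div h1 t).congr_deriv (hpt t))
      (((hA.sub (hB.const_mul _)).div_const _).sub (hC.const_mul _))]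
    simp
  rw [intervalIntegral.integral_sub ((hA.sub (hB.const_mul _)).div_const _) (hC.const_mul _),
    intervalIntegral.integral_div, intervalIntegral.integral_sub hA (hB.const_mul _),
    intervalIntegral.integral_const_mul, intervalIntegral.integral_const_mul] at hint
  rw [intervalIntegral.integral_const_mul]
  change (paramE m - (1 - m) * paramK m) / m - _ = 0 at hint
  generalize ∫ t in (0 : ℝ)..(π / 2), sin t ^ 2 / √(1 - m * sin t ^ 2) ^ 3 = J at *
  have hJ : J = (paramE m - (1 - m) * paramK m) / m / (1 - m) := by
    rw [eq_div_iff h1'.ne']; linear_combination -hint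
  rw [hJ]
  field_simp

/-- The left hand side of Legendre's relation. -/
def legendreForm (m : ℝ) : ℝ :=
  paramE m * paramK (1 - m) - paramK m * (paramK (1 - m) - paramE (1 - m))

lemma hasDerivAt_legendreForm {m : ℝ} (h0 : 0 < m) (h1 : m < 1) :
    HasDerivAt legendreForm 0 m := by
  have h1' := sub_pos.2 h1
  have e := hasDerivAt_paramE h0 h1
  have f := hasDerivAt_paramK h0 h1
  have e' := (hasDerivAt_paramE h1' (by linarith)).comp_const_sub 1 m
  have f' := (hasDerivAt_paramK h1' (by linarith)).comp_const_sub 1 m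
  refine ((e.fun_mul f').fun_sub (f.fun_mul (f'.fun_sub e'))).congr_deriv ?_
  rw [show 1 - (1 - m) = m by ring]
  field_simp
  ring

lemma legendreForm_eq {m n : ℝ} (hm : m ∈ Ioo (0 : ℝ) 1) (hn : n ∈ Ioo (0 : ℝ) 1) :
    legendreForm m = legendreForm n :=
  isOpen_Ioo.is_const_of_deriv_eq_zero isPreconnected_Ioo
    (fun _ hx => (hasDerivAt_legendreForm hx.1 hx.2).differentiableAt.differentiableWithinAt)
    (fun _ hx => (hasDerivAt_legendreForm hx.1 hx.2).deriv) hm hn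

lemma integral_const_pi_div_two (c : ℝ) : ∫ _ in (0 : ℝ)..(π / 2), c = π / 2 * c := by
  simp

lemma le_paramK {m : ℝ} (h0 : 0 < m) (h1 : m < 1) : π / 2 ≤ paramK m := by
  rw [← mul_one (π / 2), ← integral_const_pi_div_two 1]
  refine intervalIntegral.integral_mono_on pi_div_two_pos.le intervalIntegrable_const
    ((continuous_inv_sqrt_one_sub h1).intervalIntegrable _ _) fun t _ => ?_
  have hs := sqrt_pos.2 (one_sub_mul_sin_sq_pos h1 t)
  rw [le_div_iff₀ hs, one_mul, sqrt_le_one]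
  nlinarith [sq_nonneg (sin t)]

lemma paramK_le {m : ℝ} (h0 : 0 < m) (h1 : m < 1) : paramK m ≤ π / 2 * (1 / √(1 - m)) := by
  rw [← integral_const_pi_div_two]
  refine intervalIntegral.integral_mono_on pi_div_two_pos.le
    ((continuous_inv_sqrt_one_sub h1).intervalIntegrable _ _) intervalIntegrable_const
    fun t _ => ?_
  refine one_div_le_one_div_of_le (sqrt_pos.2 (sub_pos.2 h1)) (sqrt_le_sqrt ?_)
  nlinarith [sin_sq_add_cos_sq t, sq_nonneg (cos t)]

lemma paramK_sub_paramE {m : ℝ} (h1 : m < 1) : paramK m - paramE m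
    = ∫ t in (0 : ℝ)..(π / 2), m * (sin t ^ 2 / √(1 - m * sin t ^ 2)) := by
  rw [paramE, paramK, ← intervalIntegral.integral_sub
    ((continuous_inv_sqrt_one_sub h1).intervalIntegrable _ _)
    ((continuous_sqrt_one_sub m).intervalIntegrable _ _)]
  refine intervalIntegral.integral_congr fun t _ => ?_
  have hs := sqrt_pos.2 (one_sub_mul_sin_sq_pos h1 t)
  have hq := sq_sqrt (one_sub_mul_sin_sq_pos h1 t).le
  field_simp
  linear_combination -hq

lemma paramK_sub_paramE_nonneg {m : ℝ} (h0 : 0 < m) (h1 : m < 1) : 0 ≤ paramK m - paramE m := by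
  rw [paramK_sub_paramE h1]
  exact intervalIntegral.integral_nonneg pi_div_two_pos.le fun t _ => by positivity

lemma paramK_sub_paramE_le {m : ℝ} (h0 : 0 < m) (h1 : m < 1) :
    paramK m - paramE m ≤ π / 2 * (m * (1 / √(1 - m))) := by
  have h1' := sub_pos.2 h1
  rw [paramK_sub_paramE h1, ← integral_const_pi_div_two]
  refine intervalIntegral.integral_mono_on pi_div_two_pos.le
    ((continuous_const.mul (continuous_sin_sq_div h1)).intervalIntegrable _ _)
    intervalIntegrable_const fun t _ => ?_
  gcongr
  · exact sin_sq_le_one t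
  · nlinarith [sin_sq_add_cos_sq t, sq_nonneg (cos t)]

lemma one_le_paramE_one_sub {m : ℝ} (h0 : 0 < m) : 1 ≤ paramE (1 - m) := by
  have h : ∫ t in (0 : ℝ)..(π / 2), cos t = 1 := by simp
  rw [← h]
  refine intervalIntegral.integral_mono_on pi_div_two_pos.le
    (continuous_cos.intervalIntegrable _ _)
    ((continuous_sqrt_one_sub _).intervalIntegrable _ _) fun t _ => ?_
  apply le_sqrt_of_sq_le
  nlinarith [sin_sq_add_cos_sq t, sq_nonneg (sin t)]

/-- The integrand is `√(cos² t + m sin² t) ≤ cos t + √m`, since `cos t ≥ 0` on the interval. -/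
lemma paramE_one_sub_le {m : ℝ} (h0 : 0 < m) : paramE (1 - m) ≤ 1 + π / 2 * √m := by
  have h : ∫ t in (0 : ℝ)..(π / 2), cos t = 1 := by simp
  rw [← integral_const_pi_div_two, ← h, ← intervalIntegral.integral_add
    (continuous_cos.intervalIntegrable _ _) intervalIntegrable_const]
  refine intervalIntegral.integral_mono_on pi_div_two_pos.le
    ((continuous_sqrt_one_sub _).intervalIntegrable _ _)
    ((continuous_cos.add continuous_const).intervalIntegrable _ _) fun t ht => ?_
  have hc : 0 ≤ cos t := cos_nonneg_of_mem_Icc ⟨by linarith [ht.1, pi_pos], ht.2⟩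
  rw [sqrt_le_left (by positivity)]
  nlinarith [sin_sq_add_cos_sq t, sq_nonneg (cos t), sq_sqrt h0.le,
    mul_nonneg hc (sqrt_nonneg m), mul_nonneg h0.le (sq_nonneg (cos t))]

/-- Legendre's relation. -/
theorem legendreForm_eq_pi_div_two {m : ℝ} (hm : m ∈ Ioo (0 : ℝ) 1) :
    legendreForm m = π / 2 := by
  have hI : Ioo (0 : ℝ) 1 ∈ 𝓝[>] (0 : ℝ) := Ioo_mem_nhdsGT one_pos
  have hK : Tendsto paramK (𝓝[>] 0) (𝓝 (π / 2)) := by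
    have hc : ContinuousAt (fun m : ℝ => π / 2 * (1 / √(1 - m))) 0 := by
      refine continuousAt_const.mul (continuousAt_const.div (by fun_prop) (by simp))
    have hc' := hc.tendsto.mono_left (nhdsWithin_le_nhds (s := Ioi 0))
    simp only [sub_zero, sqrt_one, div_one, mul_one] at hc'
    refine tendsto_of_tendsto_of_tendsto_of_le_of_le' tendsto_const_nhds hc' ?_ ?_
    · filter_upwards [hI] with x hx using le_paramK hx.1 hx.2
    · filter_upwards [hI] with x hx using paramK_le hx.1 hx.2
  have hE : Tendsto (fun m => paramE (1 - m)) (𝓝[>] 0) (𝓝 1) := by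
    have hc : Continuous (fun m : ℝ => 1 + π / 2 * √m) := by fun_prop
    have hc' := (hc.tendsto 0).mono_left (nhdsWithin_le_nhds (s := Ioi 0))
    simp only [sqrt_zero, mul_zero, add_zero] at hc'
    refine tendsto_of_tendsto_of_tendsto_of_le_of_le' tendsto_const_nhds hc' ?_ ?_
    · filter_upwards [hI] with x hx using one_le_paramE_one_sub hx.1
    · filter_upwards [hI] with x hx using paramE_one_sub_le hx.1
  -- Although `paramK (1 - m)` is unbounded, the crude bound `O(m^(-1/2))` suffices, because `paramK
  -- m - paramE m` is `O(m)`.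
  have hP : Tendsto (fun m => (paramK m - paramE m) * paramK (1 - m)) (𝓝[>] 0) (𝓝 0) := by
    have hc : ContinuousAt (fun m : ℝ => (π / 2) ^ 2 * (√m * (1 / √(1 - m)))) 0 := by
      refine continuousAt_const.mul (ContinuousAt.mul (by fun_prop)
        (continuousAt_const.div (by fun_prop) (by simp)))
    have hc' := hc.tendsto.mono_left (nhdsWithin_le_nhds (s := Ioi 0))
    simp only [sqrt_zero, zero_mul, mul_zero] at hc'
    refine tendsto_of_tendsto_of_tendsto_of_le_of_le' tendsto_const_nhds hc' ?_ ?_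
    · filter_upwards [hI] with x hx
      have h1' := sub_pos.2 hx.2
      exact mul_nonneg (paramK_sub_paramE_nonneg hx.1 hx.2)
        (pi_div_two_pos.le.trans (le_paramK h1' (by linarith [hx.1])))
    · filter_upwards [hI] with x hx
      have h1' := sub_pos.2 hx.2
      have hle := paramK_le h1' (by linarith [hx.1])
      rw [sub_sub_cancel] at hle
      refine (mul_le_mul (paramK_sub_paramE_le hx.1 hx.2) hle
        (pi_div_two_pos.le.trans (le_paramK h1' (by linarith [hx.1]))) ?_).trans_eq ?_
      · have := hx.1
        positivity
      · have hs := sqrt_pos.2 hx.1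
        have hq := sq_sqrt hx.1.le
        field_simp
        linear_combination -hq
  have hL : Tendsto legendreForm (𝓝[>] 0) (𝓝 (π / 2 * 1 - 0)) :=
    ((hK.mul hE).sub hP).congr fun m => by rw [legendreForm]; ring
  have hC : Tendsto legendreForm (𝓝[>] 0) (𝓝 (legendreForm m)) :=
    tendsto_const_nhds.congr' (by filter_upwards [hI] with x hx using legendreForm_eq hm hx)
  rw [tendsto_nhds_unique hC hL, mul_one, sub_zero]

/-! ### The terms of `T̃` under the deck transformation -/

lemma continuous_delta (k : ℝ) : Continuous (delta k) := by
  unfold delta; fun_prop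

lemma hasDerivAt_delta {k : ℝ} (hk : 0 < k) (x : ℝ) :
    HasDerivAt (delta k) (-((1 - k ^ 2) * sin (x / 2) * cos (x / 2)) / (2 * delta k x)) x := by
  have hd := delta_pos hk x
  have hp : 0 < cos (x / 2) ^ 2 + k ^ 2 * sin (x / 2) ^ 2 := rescale_den_pos (pow_pos hk 2) x
  have h := (((hasDerivAt_half_cos x).fun_pow 2).fun_add
    (((hasDerivAt_half_sin x).fun_pow 2).const_mul (k ^ 2))).sqrt hp.ne'
  refine h.congr_deriv ?_
  change _ / (2 * delta k x) = _
  congr 1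
  push_cast
  ring

lemma continuous_one_div_delta {k : ℝ} (hk : 0 < k) : Continuous fun s => 1 / delta k s :=
  continuous_const.div (continuous_delta k) fun s => (delta_pos hk s).ne'

lemma continuous_one_div_delta_add {k : ℝ} (hk : 0 < k) :
    Continuous fun s => 1 / (delta k s + k) :=
  continuous_const.div ((continuous_delta k).add continuous_const)
    fun s => (add_pos (delta_pos hk s) hk).ne'

lemma one_sub_sq_mul_half_sin_sq (k x : ℝ) :
    (1 - k ^ 2) * sin (x / 2) ^ 2 = 1 - delta k x ^ 2 := by
  linear_combination sin_sq_add_cos_sq (x / 2) + delta_sq k x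

lemma one_sub_sq_mul_half_cos_sq (k x : ℝ) :
    (1 - k ^ 2) * cos (x / 2) ^ 2 = delta k x ^ 2 - k ^ 2 := by
  linear_combination -delta_sq k x - k ^ 2 * sin_sq_add_cos_sq (x / 2)

lemma hasDerivAt_liftedF {k : ℝ} (hk : 0 < k) (x : ℝ) :
    HasDerivAt (fun x => liftedF x k) (1 / 2 * (1 / delta k x)) x :=
  ((continuous_one_div_delta hk).integral_hasStrictDerivAt 0 x).hasDerivAt.const_mul _

lemma hasDerivAt_liftedE {k : ℝ} (hk : 0 < k) (x : ℝ) :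
    HasDerivAt (fun x => liftedE x k) (1 / 2 * (1 - k ^ 2) * (1 / (delta k x + k))) x :=
  ((continuous_one_div_delta_add hk).integral_hasStrictDerivAt 0 x).hasDerivAt.const_mul _

/-- Invariance of `dx/δ` makes the difference constant; it is evaluated at `0`, which is sent to
`π`. -/
lemma liftedF_deckLift {k : ℝ} (hk : 0 < k) (x : ℝ) :
    liftedF (deckLift k x) k - liftedF x k = liftedF π k := by
  have hder : ∀ y, HasDerivAt (fun y => liftedF (deckLift k y) k - liftedF y k) 0 y := fun y => by
    have hd := delta_pos hk y
    refine (((hasDerivAt_liftedF hk (deckLift k y)).comp y (hasDerivAt_deckLift hk y)).sub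
      (hasDerivAt_liftedF hk y)).congr_deriv ?_
    rw [delta_deckLift hk]
    field_simp
    ring
  have h := is_const_of_deriv_eq_zero (fun y => (hder y).differentiableAt)
    (fun y => (hder y).deriv) x 0
  simp only [deckLift_zero] at h
  rw [h]
  simp [liftedF]

/-- The change of `liftedE`, up to a constant, and of `boundaryTerm` under the deck
transformation: `(1 - w(i t)) / t + k t`, `t = tan (x/2)`, extended analytically. -/
def deckCorrection (k x : ℝ) : ℝ :=
  -((1 - k) ^ 2 * (1 + k)) * (sin (x / 2) * cos (x / 2) / ((delta k x + 1) * (delta k x + k)))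

/-- The pulled-back integrand is a multiple of `1/(δ (δ + 1))` instead of `1/(δ + k)`; the
difference has the algebraic primitive `deckCorrection`. -/
lemma liftedE_deckLift {k : ℝ} (hk : 0 < k) (hk1 : k < 1) (x : ℝ) :
    liftedE (deckLift k x) k - liftedE x k = liftedE π k + deckCorrection k x := by
  have hk2 : 0 < 1 - k ^ 2 := by nlinarith
  have hder : ∀ y, HasDerivAt (fun y => liftedE (deckLift k y) k - liftedE y k
      - deckCorrection k y) 0 y := fun y => by
    have hd := delta_pos hk y
    have hs := one_sub_sq_mul_half_sin_sq k y
    have hc := one_sub_sq_mul_half_cos_sq k y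
    have hden : (delta k y + 1) * (delta k y + k) ≠ 0 := by positivity
    refine ((((hasDerivAt_liftedE hk (deckLift k y)).comp y (hasDerivAt_deckLift hk y)).sub
      (hasDerivAt_liftedE hk y)).sub ((((hasDerivAt_half_sin y).fun_mul
        (hasDerivAt_half_cos y)).fun_div (((hasDerivAt_delta hk y).add_const 1).fun_mul
          ((hasDerivAt_delta hk y).add_const k)) hden).const_mul _)).congr_deriv ?_
    rw [delta_deckLift hk]
    generalize delta k y = d at *
    generalize sin (y / 2) = s at *
    generalize cos (y / 2) = c at *
    -- Both squares `s²` and `c²` are affine in `d²`, so the claim becomes a rational identity in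
    -- `d` and `k`.
    have e1 : c / 2 * c + s * (-s / 2) = (2 * d ^ 2 - k ^ 2 - 1) / (2 * (1 - k ^ 2)) := by
      rw [eq_div_iff (by positivity)]
      linear_combination hc - hs
    have e2 : s * c * (-((1 - k ^ 2) * s * c) / (2 * d))
        = -((1 - d ^ 2) * (d ^ 2 - k ^ 2)) / (2 * d * (1 - k ^ 2)) := by
      rw [← hs, ← hc]
      field_simp
    rw [e1, show ∀ X, s * c * (X * (d + k) + (d + 1) * X) = s * c * X * (2 * d + 1 + k) by
      intro X; ring, e2]
    field_simp
    ring
  have h := is_const_of_deriv_eq_zero (fun y => (hder y).differentiableAt)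
    (fun y => (hder y).deriv) x 0
  simp only [deckLift_zero] at h
  rw [show liftedE 0 k = 0 by simp [liftedE], show deckCorrection k 0 = 0 by
    simp [deckCorrection]] at h
  linarith

/-- After the splittings `l1` and `l2`, the leading terms cancel in the difference. What remains
contains the factor `sin ((x - y)/2)`, which cancels the denominator; hence the result does not
depend on `y`. -/
lemma boundaryTerm_deckLift {k : ℝ} (hk : 0 < k) (hk1 : k < 1) {x y : ℝ} (hxy : sin ((x - y) / 2) ≠ 0) :
    boundaryTerm k (deckLift k x) (deckLift k y) - boundaryTerm k x y = deckCorrection k x := by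
  have hx := delta_pos hk x
  have hy := delta_pos hk y
  have hk2 : 0 < 1 - k ^ 2 := by nlinarith
  have d1 : 0 < delta k x + k * sin (x / 2) ^ 2 := by positivity
  have d2 : 0 < delta k x + cos (x / 2) ^ 2 := by positivity
  have l1 : (1 + k ^ 2 * sin (x / 2) ^ 2) / (delta k x + k * sin (x / 2) ^ 2)
      = 1 + (1 - k) ^ 2 * (1 + k) * sin (x / 2) ^ 2 / ((delta k x + 1) * (delta k x + k)) := by
    have hs : sin (x / 2) ^ 2 = (1 - delta k x ^ 2) / (1 - k ^ 2) := by
      rw [eq_div_iff hk2.ne']; linear_combination one_sub_sq_mul_half_sin_sq k x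
    rw [div_eq_iff d1.ne', hs]
    field_simp
    ring
  have l2 : (delta k x ^ 2 + k ^ 2 * cos (x / 2) ^ 2) / (delta k x + cos (x / 2) ^ 2)
      = k + (1 - k) ^ 2 * (1 + k) * cos (x / 2) ^ 2 / ((delta k x + 1) * (delta k x + k)) := by
    have hc : cos (x / 2) ^ 2 = (delta k x ^ 2 - k ^ 2) / (1 - k ^ 2) := by
      rw [eq_div_iff hk2.ne']; linear_combination one_sub_sq_mul_half_cos_sq k x
    rw [div_eq_iff d2.ne', hc]
    field_simp
    ring
  have e : boundaryTerm k (deckLift k x) (deckLift k y) =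
      (sin (x / 2) * sin (y / 2) * ((delta k x ^ 2 + k ^ 2 * cos (x / 2) ^ 2)
        / (delta k x + cos (x / 2) ^ 2)) + cos (x / 2) * cos (y / 2)) / sin ((x - y) / 2) := by
    rw [boundaryTerm, sin_half_sub_deckLift hk, delta_deckLift hk, cos_half_deckLift hk,
      cos_half_deckLift hk, sin_half_deckLift hk, sin_half_deckLift hk]
    field_simp
  rw [e, l2, boundaryTerm, mul_div_assoc (cos (x / 2) * cos (y / 2)), l1, ← sub_div, div_eq_iff hxy, deckCorrection, sub_div,
    sin_sub]
  field_simp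
  ring

/-! ### Periods of the lifted integrals and the change of `T̃` -/

lemma ellipticK_eq_paramK (k : ℝ) : ellipticK k = paramK (k ^ 2) := rfl

lemma ellipticE_eq_paramE (k : ℝ) : ellipticE k = paramE (k ^ 2) := rfl

lemma delta_two_mul (k t : ℝ) : delta k (2 * t) = √(1 - (1 - k ^ 2) * sin t ^ 2) := by
  rw [delta, mul_div_cancel_left₀ t two_ne_zero, cos_sq']
  congr 1
  ring

lemma half_integral_zero_pi (f : ℝ → ℝ) :
    1 / 2 * ∫ s in (0 : ℝ)..π, f s = ∫ t in (0 : ℝ)..(π / 2), f (2 * t) := by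
  rw [intervalIntegral.integral_comp_mul_left f two_ne_zero, mul_zero,
    mul_div_cancel₀ π two_ne_zero, smul_eq_mul, one_div]

lemma liftedF_pi (k : ℝ) : liftedF π k = paramK (1 - k ^ 2) := by
  rw [liftedF, half_integral_zero_pi]
  simp only [delta_two_mul]
  rfl

/-- The integrands `(1 - k²)/(δ + k)` and `1/δ - δ` differ by the derivative of `2 (1 - k²) sin
(y/2) cos (y/2) / (δ + k)`, which vanishes at `0` and at `π`. -/
lemma liftedE_pi {k : ℝ} (hk : 0 < k) (hk1 : k < 1) :
    liftedE π k = paramK (1 - k ^ 2) - paramE (1 - k ^ 2) := by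
  have hm : 1 - k ^ 2 < 1 := by linarith [pow_pos hk 2]
  have hd := continuous_one_div_delta hk
  have hk2 : 0 < 1 - k ^ 2 := by nlinarith
  have hder : ∀ y, HasDerivAt (fun y => 2 * (1 - k ^ 2) *
      (sin (y / 2) * cos (y / 2) / (delta k y + k)))
      ((1 - k ^ 2) * (1 / (delta k y + k)) - (1 / delta k y - delta k y)) y := fun y => by
    have hd := delta_pos hk y
    have hs := one_sub_sq_mul_half_sin_sq k y
    have hc := one_sub_sq_mul_half_cos_sq k y
    have hden : delta k y + k ≠ 0 := by positivity
    refine ((((hasDerivAt_half_sin y).fun_mul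
        (hasDerivAt_half_cos y)).fun_div ((hasDerivAt_delta hk y).add_const k)
          hden).const_mul _).congr_deriv ?_
    generalize delta k y = d at *
    generalize sin (y / 2) = s at *
    generalize cos (y / 2) = c at *
    have e1 : c / 2 * c + s * (-s / 2) = (2 * d ^ 2 - k ^ 2 - 1) / (2 * (1 - k ^ 2)) := by
      rw [eq_div_iff (by positivity)]
      linear_combination hc - hs
    have e2 : s * c * (-((1 - k ^ 2) * s * c) / (2 * d))
        = -((1 - d ^ 2) * (d ^ 2 - k ^ 2)) / (2 * d * (1 - k ^ 2)) := by
      rw [← hs, ← hc]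
      field_simp
    rw [e1, e2]
    field_simp
    ring
  have i1 := (continuous_one_div_delta_add hk).intervalIntegrable
    (μ := MeasureTheory.volume) 0 π
  have i2 := hd.intervalIntegrable (μ := MeasureTheory.volume) 0 π
  have i3 := (continuous_delta k).intervalIntegrable (μ := MeasureTheory.volume) 0 π
  have h := intervalIntegral.integral_eq_sub_of_hasDerivAt (a := 0) (b := π)
    (fun y _ => hder y) ((i1.const_mul _).sub (i2.sub i3))
  rw [intervalIntegral.integral_sub (i1.const_mul _) (i2.sub i3),
    intervalIntegral.integral_sub i2 i3, intervalIntegral.integral_const_mul] at h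
  simp only [cos_pi_div_two, zero_div, sin_zero, mul_zero, zero_mul, sub_zero] at h
  have hK := liftedF_pi k
  rw [liftedF] at hK
  have hE : 1 / 2 * ∫ s in (0 : ℝ)..π, delta k s = paramE (1 - k ^ 2) := by
    rw [half_integral_zero_pi]
    simp only [delta_two_mul]
    rfl
  rw [liftedE]
  linarith

/-- Legendre's relation in terms of the periods of the lifted elliptic integrals. -/
lemma legendre_relation {k : ℝ} (h0 : 0 < k) (h1 : k < 1) :
    ellipticE k * liftedF π k - ellipticK k * liftedE π k = π / 2 := by
  rw [liftedF_pi, liftedE_pi h0 h1, ellipticE_eq_paramE, ellipticK_eq_paramK]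
  exact legendreForm_eq_pi_div_two ⟨by positivity, by nlinarith⟩

theorem liftedT_deck (x : Cover) : liftedT (deck x) - liftedT x = x.p - 1 := by
  have hk := x.k_pos
  have hL := legendre_relation hk x.k_lt_one
  have hs := x.sin_ne
  have hs' : sin ((x.v - x.u) / 2) ≠ 0 := by
    rw [show (x.v - x.u) / 2 = -((x.u - x.v) / 2) by ring, sin_neg]
    exact neg_ne_zero.2 hs
  have a := liftedF_deckLift hk x.u
  have b := liftedF_deckLift hk x.v
  have c := liftedE_deckLift hk x.k_lt_one x.u
  have d := liftedE_deckLift hk x.k_lt_one x.v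
  have e := boundaryTerm_deckLift hk x.k_lt_one hs
  have f := boundaryTerm_deckLift hk x.k_lt_one hs'
  rw [liftedT, liftedT, deck_p, deck_k, deck_u, deck_v, ← sub_div,
    div_eq_iff (by positivity)]
  rw [sub_eq_iff_eq_add] at a b c d e f
  rw [a, b, c, d, e, f]
  -- The corrections at `ũ` and at `ṽ` cancel separately, the latter with weight `p`; only the
  -- constant periods remain.
  linear_combination 4 * (x.p - 1) * hL

end GenusOne

end

theorem mainTheorem7 :
    (∀ x : GenusOne.Cover,
      GenusOne.proj (GenusOne.deck x) = GenusOne.swap (GenusOne.proj x)) ∧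
    (∀ x : GenusOne.Cover,
      GenusOne.liftedT (GenusOne.deck x) - GenusOne.liftedT x
        = GenusOne.S (GenusOne.proj x) - 1) ∧
    (∀ p : ℝ, 0 < p → ∀ x ∈ GenusOne.levelSet p,
      GenusOne.deck x ∈ GenusOne.levelSet p ∧
      (p ≤ 1 → ∀ (q : ℝ) (k : Set.Ioo (0 : ℝ) 1) (X : ℝ), GenusOne.chartU x = (q, k, X) →
        GenusOne.chartU (GenusOne.deck x) = (q + (p - 1), k, X + Real.pi)) ∧
      (1 ≤ p → ∀ (q : ℝ) (k : Set.Ioo (0 : ℝ) 1) (X : ℝ), GenusOne.chartV x = (q, k, X) →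
        GenusOne.chartV (GenusOne.deck x) = (q + (p - 1), k, X + Real.pi))) := by
  refine ⟨GenusOne.proj_deck, fun x => ?_, fun p _ x hx => ⟨?_, ?_, ?_⟩⟩
  · rw [GenusOne.liftedT_deck, GenusOne.S_proj]
  · change GenusOne.S _ = p
    rw [GenusOne.S_proj, GenusOne.deck_p, ← GenusOne.S_proj]
    exact hx
  · rintro - q k X h
    have hp : x.p = p := (GenusOne.S_proj x).symm.trans hx
    obtain ⟨h1, h2, h3⟩ := by simpa only [GenusOne.chartU, Prod.mk.injEq] using h
    have hT := GenusOne.liftedT_deck x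
    refine Prod.ext ?_ (Prod.ext h2 ?_)
    · change GenusOne.liftedT _ = q + (p - 1)
      linarith
    · exact (GenusOne.translate_U Real.pi x).trans (by rw [h3])
  · rintro - q k X h
    have hp : x.p = p := (GenusOne.S_proj x).symm.trans hx
    obtain ⟨h1, h2, h3⟩ := by simpa only [GenusOne.chartV, Prod.mk.injEq] using h
    have hT := GenusOne.liftedT_deck x
    refine Prod.ext ?_ (Prod.ext h2 ?_)
    · change GenusOne.liftedT _ = q + (p - 1)
      linarith
    · exact (GenusOne.translate_V Real.pi x).trans (by rw [h3])
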